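/- **Setting.** Let $d\in\mathbb N$, $a<b$, and let $P_0,P_1\in\mathbb R^{d\times d}$ with $P_0^\top=-P_0$, $P_1^\top=P_1$ and $P_1$ invertible. Let $\mathcal H:(a,b)\to\mathbb R^{d\times d}$ be measurable with symmetric values, bounded, and such that for some $k>0$ one has $k|\xi|^2\le \xi^\top\mathcal H(x)\xi$ for all $\xi\in\mathbb R^d$ and almost every $x$. Let $W\in\mathbb R^{d\times 2d}$ have rank $d$. Let $H$ be the (complexified) Hilbert space $L^2([a,b];\mathbb C^d)$ with norm $\|u\|_H=\|\mathcal H^{1/2}u\|_{L^2}$, and let $$\operatorname{dom}\mathcal A=\Big\{u\in H:\ \mathcal Hu\in H^1([a,b];\mathbb C^d),\ W\begin{bmatrix}(\mathcal Hu)(b)\\(\mathcal Hu)(a)\end{bmatrix}=0\Big\},\qquad \mathcal Au=P_1(\mathcal Hu)'+P_0\mathcal Hu .$$ Assume that $\mathcal A$ is accretive on $H$, i.e. $\operatorname{Re}\langle\mathcal Au,u\rangle_H\ge0$ for $u\in\operatorname{dom}\mathcal A$ (so that $-\mathcal A$ generates a contraction semigroup, the port-Hamiltonian semigroup). For $t\in\mathbb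 R$ let $\Phi_t:[a,b]\to\mathbb C^{d\times d}$ be the fundamental matrix, that is, the absolutely continuous solution of $$\Phi_t'(x)=-P_1^{-1}\big(\mathrm i t\,\mathcal H(x)^{-1}+P_0\big)\Phi_t(x)\ \text{ for a.e. }x\in[a,b],\qquad \Phi_t(a)=1_d,$$ where $1_d$ denotes the identity matrix, and put $T_t=W\begin{bmatrix}\Phi_t(b)\\1_d\end{bmatrix}\in\mathbb C^{d\times d}$. **Statement.** Assume that $\mathrm i\mathbb R\subseteq\rho(\mathcal A)$ and that condition (B) holds: $\sup_{t\in\mathbb R}\sup_{x\in[a,b]}\|\Phi_t(x)\|<\infty$. Then $T_t$ is invertible for every $t\in\mathbb R$, and for every $\eta\ge0$ the quantities $$M(\eta)=\sup_{t\in[-\eta,\eta]}\big\|(\mathrm it+\mathcal A)^{-1}\big\|,\qquad m(\eta)=\sup_{t\in[-\eta,\eta]}\|T_t^{-1}\|$$ are finite; here $M$ uses the operator norm on $H$, $m$ the operator norm induced by the Euclidean norm on $\mathbb C^d$, and $(\mathrm it+\mathcal A)^{-1}=R(\mathrm it,-\mathcal A)$ is the resolvent of the generator $-\mathcal A$. Moreover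 there are constants $c,C>0$ such that $$c\,m(\eta)\le M(\eta)\le C\,m(\eta)\qquad\text{for all }\eta\ge0 .$$ -/

import Mathlib

open MeasureTheory Set

/-- Existence for linear integral equations with bounded measurable coefficients; only used to
know that the fundamental matrix below exists. -/
theorem exists_linear_volterra_solution {E : Type*} [NormedRing E] [NormedSpace ℝ E]
    [CompleteSpace E] {a b : ℝ} (A : ℝ → E) (L : ℝ)
    (hA : AEStronglyMeasurable A (volume.restrict (Icc a b)))
    (hL : ∀ᵐ s ∂(volume.restrict (Icc a b)), ‖A s‖ ≤ L) :
    ∃ Φ : ℝ → E, ContinuousOn Φ (Icc a b) ∧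
      ∀ x ∈ Icc a b, Φ x = 1 + ∫ s in a..x, A s * Φ s := by
  classical
  set A' : ℝ → E := (Icc a b).indicator A with hA'
  set K : ℝ := max L 0 with hK
  have hK0 : 0 ≤ K := le_max_right _ _
  have hmeas : AEStronglyMeasurable A' volume :=
    (aestronglyMeasurable_indicator_iff measurableSet_Icc).2 hA
  have hbd : ∀ᵐ s ∂(volume : Measure ℝ), ‖A' s‖ ≤ K := by
    filter_upwards [(ae_restrict_iff' measurableSet_Icc).1 hL] with s hs
    by_cases h : s ∈ Icc a b
    · rw [hA', indicator_of_mem h]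
      exact (hs h).trans (le_max_left _ _)
    · simpa [hA', indicator_of_notMem h] using hK0
  let I : ℕ → ℝ → E := fun n => Nat.rec (fun _ => 1) (fun _ g x => ∫ s in a..x, A' s * g s) n
  have I0 : I 0 = fun _ => 1 := rfl
  have IS : ∀ n x, I (n + 1) x = ∫ s in a..x, A' s * I n s := fun n x => rfl
  have hint : ∀ g : ℝ → E, Continuous g → ∀ c d : ℝ,
      IntervalIntegrable (fun s => A' s * g s) volume c d := by
    intro g hg c d
    have h1 : IntervalIntegrable A' volume c d :=
      (intervalIntegrable_const (c := K)).mono_fun hmeas.restrict (by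
        filter_upwards [ae_restrict_of_ae hbd] with s hs
        exact hs.trans (le_abs_self K))
    exact h1.mul_continuousOn hg.continuousOn
  have Icont : ∀ n, Continuous (I n) := by
    intro n
    induction n with
    | zero => exact continuous_const
    | succ n ih => exact intervalIntegral.continuous_primitive (hint _ ih) a
  have Ibd : ∀ n, ∀ x, a ≤ x → ‖I n x‖ ≤ ‖(1 : E)‖ * ((K * (x - a)) ^ n / n.factorial) := by
    intro n
    induction n with
    | zero => intro x _; simp [I0]
    | succ n ih =>
      intro x hx
      rw [IS]
      have hc : Continuous fun s : ℝ =>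
          K * (‖(1 : E)‖ * ((K * (s - a)) ^ n / n.factorial)) := by fun_prop
      calc ‖∫ s in a..x, A' s * I n s‖
          ≤ ∫ s in a..x, K * (‖(1 : E)‖ * ((K * (s - a)) ^ n / n.factorial)) := by
            refine intervalIntegral.norm_integral_le_of_norm_le hx ?_ (hc.intervalIntegrable _ _)
            filter_upwards [hbd] with s hs hsx
            exact (norm_mul_le _ _).trans
              (mul_le_mul hs (ih s hsx.1.le) (norm_nonneg _) hK0)
        _ = ‖(1 : E)‖ * ((K * (x - a)) ^ (n + 1) / (n + 1).factorial) := by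
            have h : ∀ s : ℝ, K * (‖(1 : E)‖ * ((K * (s - a)) ^ n / n.factorial)) =
                (K ^ (n + 1) * ‖(1 : E)‖ / n.factorial) * (s - a) ^ n := by
              intro s; rw [mul_pow]; ring
            simp_rw [h]
            rw [intervalIntegral.integral_const_mul,
              intervalIntegral.integral_comp_sub_right (fun s => s ^ n) a, integral_pow]
            rw [Nat.factorial_succ]
            have : (n.factorial : ℝ) ≠ 0 := by positivity
            push_cast
            rw [sub_self, mul_pow, zero_pow (Nat.succ_ne_zero n)]
            field_simp
            ring
  have hsum : Summable fun n : ℕ => ‖(1 : E)‖ * ((K * (b - a)) ^ n / n.factorial) :=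
    (Real.summable_pow_div_factorial _).mul_left _
  have Ibd' : ∀ n, ∀ x ∈ Icc a b,
      ‖I n x‖ ≤ ‖(1 : E)‖ * ((K * (b - a)) ^ n / n.factorial) := by
    intro n x hx
    refine (Ibd n x hx.1).trans ?_
    have : 0 ≤ x - a := sub_nonneg.2 hx.1
    have : x - a ≤ b - a := by linarith [hx.2]
    gcongr
  have hS : ∀ x ∈ Icc a b, Summable fun n => I n x := fun x hx =>
    Summable.of_norm_bounded hsum (fun n => Ibd' n x hx)
  refine ⟨fun x => ∑' n, I n x,
    continuousOn_tsum (fun n => (Icont n).continuousOn) hsum Ibd', fun x hx => ?_⟩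
  have hsub : ∀ s ∈ uIoc a x, s ∈ Icc a b := by
    intro s hs
    rw [uIoc_of_le hx.1] at hs
    exact ⟨hs.1.le, hs.2.trans hx.2⟩
  have key : HasSum (fun n => ∫ s in a..x, A' s * I n s)
      (∫ s in a..x, A' s * ∑' n, I n s) := by
    refine intervalIntegral.hasSum_integral_of_dominated_convergence
      (fun n _ => K * (‖(1 : E)‖ * ((K * (b - a)) ^ n / n.factorial)))
      (fun n => (hmeas.mul (Icont n).aestronglyMeasurable).restrict) ?_ ?_ ?_ ?_
    · intro n
      filter_upwards [hbd] with s hs hsx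
      exact (norm_mul_le _ _).trans
        (mul_le_mul hs (Ibd' n s (hsub s hsx)) (norm_nonneg _) hK0)
    · exact Filter.Eventually.of_forall fun s _ => hsum.mul_left _
    · exact intervalIntegrable_const
    · exact Filter.Eventually.of_forall fun s hs => (hS s (hsub s hs)).hasSum.mul_left _
  have hcongr : (∫ s in a..x, A' s * ∑' n, I n s) = ∫ s in a..x, A s * ∑' n, I n s := by
    refine intervalIntegral.integral_congr_ae (Filter.Eventually.of_forall fun s hs => ?_)
    simp only [hA', indicator_of_mem (hsub s hs)]
  change ∑' n, I n x = 1 + ∫ s in a..x, A s * ∑' n, I n s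
  rw [(hS x hx).tsum_eq_zero_add, ← hcongr, ← key.tsum_eq]
  simp only [IS, I0]

/- Matrices carry the operator norm induced by the Euclidean norms. -/
open scoped Matrix.Norms.L2Operator

/-- The entrywise inclusion of real matrices into complex matrices. -/
abbrev complexify {m n : Type*} (M : Matrix m n ℝ) : Matrix m n ℂ :=
  M.map (fun r : ℝ => (r : ℂ))

/-- The data of a port-Hamiltonian system on `[a, b]`: `P₀ = -P₀ᵀ`, `P₁ = P₁ᵀ` invertible, a
measurable, symmetric, bounded and uniformly positive definite `ℋ`, and a full rank matrix
`W ∈ ℝ^{d × 2d}` of boundary conditions (its columns indexed by `Fin d ⊕ Fin d`). The conditions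
on `ℋ` are only required almost everywhere; values of `ℋ` outside `[a, b]` play no role. -/
structure PortHamiltonian (d : ℕ) where
  a : ℝ
  b : ℝ
  a_lt_b : a < b
  P₀ : Matrix (Fin d) (Fin d) ℝ
  P₁ : Matrix (Fin d) (Fin d) ℝ
  /-- the Hamiltonian density -/
  ℋ : ℝ → Matrix (Fin d) (Fin d) ℝ
  /-- the boundary matrix -/
  W : Matrix (Fin d) (Fin d ⊕ Fin d) ℝ
  P₀_skew : P₀.transpose = -P₀
  P₁_symm : P₁.transpose = P₁
  P₁_isUnit : IsUnit P₁
  ℋ_meas : ∀ i j, AEMeasurable (fun x => ℋ x i j) (volume.restrict (Icc a b))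
  ℋ_symm : ∀ᵐ x ∂(volume.restrict (Icc a b)), (ℋ x).transpose = ℋ x
  ℋ_lower : ∃ k : ℝ, 0 < k ∧ ∀ᵐ x ∂(volume.restrict (Icc a b)),
    ∀ ξ : Fin d → ℝ, k * (ξ ⬝ᵥ ξ) ≤ ξ ⬝ᵥ (ℋ x).mulVec ξ
  ℋ_upper : ∃ K : ℝ, ∀ᵐ x ∂(volume.restrict (Icc a b)), ‖ℋ x‖ ≤ K
  W_rank : W.rank = d

namespace PortHamiltonian

variable {d : ℕ} (S : PortHamiltonian d)

/-- Lebesgue measure on `[a, b]`. -/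
noncomputable abbrev μ : Measure ℝ := volume.restrict (Icc S.a S.b)

/-- Action of a real matrix on `ℂ^d`. -/
noncomputable abbrev act (M : Matrix (Fin d) (Fin d) ℝ) :
    EuclideanSpace ℂ (Fin d) →L[ℂ] EuclideanSpace ℂ (Fin d) :=
  Matrix.toEuclideanCLM (n := Fin d) (𝕜 := ℂ) (complexify M)

theorem exists_norm_act_le (d : ℕ) : ∃ c : ℝ, 0 ≤ c ∧ ∀ M : Matrix (Fin d) (Fin d) ℝ,
    ‖complexify M‖ ≤ c * ‖M‖ := by
  let f : Matrix (Fin d) (Fin d) ℝ →ₗ[ℝ] Matrix (Fin d) (Fin d) ℂ :=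
    { toFun := complexify
      map_add' := fun A B => by ext; simp
      map_smul' := fun r A => by ext; simp }
  have h := (LinearMap.toContinuousLinearMap f).le_opNorm
  exact ⟨‖LinearMap.toContinuousLinearMap f‖, ContinuousLinearMap.opNorm_nonneg _, h⟩

theorem aestronglyMeasurable_complexify {μ : Measure ℝ} {F : ℝ → Matrix (Fin d) (Fin d) ℝ}
    (hF : ∀ i j, AEMeasurable (fun x => F x i j) μ) :
    AEStronglyMeasurable (fun x => complexify (F x)) μ := by
  have h : AEStronglyMeasurable (fun x => (fun i j => F x i j : Fin d → Fin d → ℝ)) μ :=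
    (aemeasurable_pi_lambda _ fun i => aemeasurable_pi_lambda _ fun j =>
      hF i j).aestronglyMeasurable
  have hc : Continuous fun g : Fin d → Fin d → ℝ => complexify (Matrix.of g) := by
    refine Continuous.matrix_map ?_ Complex.continuous_ofReal
    exact continuous_id
  exact hc.comp_aestronglyMeasurable h

theorem aestronglyMeasurable_act {f : ℝ → EuclideanSpace ℂ (Fin d)}
    (hf : AEStronglyMeasurable f S.μ) :
    AEStronglyMeasurable (fun x => act (S.ℋ x) (f x)) S.μ := by
  have h2 : AEStronglyMeasurable
      (fun x => (fun i => ∑ j, ((S.ℋ x i j : ℝ) : ℂ) * f x j : Fin d → ℂ)) S.μ := by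
    refine AEMeasurable.aestronglyMeasurable (aemeasurable_pi_lambda _ fun i => ?_)
    refine Finset.aemeasurable_fun_sum _ fun j _ => ?_
    have hj : AEStronglyMeasurable (fun x => f x j) S.μ :=
      (EuclideanSpace.proj (𝕜 := ℂ) j).continuous.comp_aestronglyMeasurable hf
    exact (Complex.measurable_ofReal.comp_aemeasurable (S.ℋ_meas i j)).mul hj.aemeasurable
  exact (PiLp.continuous_toLp 2 _).comp_aestronglyMeasurable h2

theorem integrable_inner_aux (u v : Lp (EuclideanSpace ℂ (Fin d)) 2 S.μ) :
    Integrable (fun x => inner ℂ (u x) (act (S.ℋ x) (v x))) S.μ := by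
  obtain ⟨c, hc0, hc⟩ := exists_norm_act_le d
  obtain ⟨K, hK⟩ := S.ℋ_upper
  have hv : MemLp (fun x => act (S.ℋ x) (v x)) 2 S.μ := by
    refine (Lp.memLp v).of_le_mul (c := c * K)
      (S.aestronglyMeasurable_act (Lp.aestronglyMeasurable v)) ?_
    filter_upwards [hK] with x hx
    refine (ContinuousLinearMap.le_opNorm _ _).trans ?_
    gcongr
    exact (hc _).trans (by gcongr)
  exact (L2.integrable_inner (𝕜 := ℂ) u (hv.toLp _)).congr (by
    filter_upwards [hv.coeFn_toLp] with x hx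
    rw [hx])

theorem inner_act_symm {M : Matrix (Fin d) (Fin d) ℝ} (hM : M.transpose = M)
    (u v : EuclideanSpace ℂ (Fin d)) :
    inner ℂ (act M u) v = inner ℂ u (act M v) := by
  have h : ContinuousLinearMap.adjoint (act M) = act M := by
    have := map_star (Matrix.toEuclideanCLM (n := Fin d) (𝕜 := ℂ)) (complexify M)
    rw [ContinuousLinearMap.star_eq_adjoint] at this
    rw [act, ← this]
    congr 1
    ext i j
    simp [← congrFun (congrFun hM i) j]
  rw [← ContinuousLinearMap.adjoint_inner_right, h]

theorem le_re_inner_act {M : Matrix (Fin d) (Fin d) ℝ} {k : ℝ}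
    (hM : ∀ ξ : Fin d → ℝ, k * (ξ ⬝ᵥ ξ) ≤ ξ ⬝ᵥ M.mulVec ξ) (u : EuclideanSpace ℂ (Fin d)) :
    k * ‖u‖ ^ 2 ≤ (inner ℂ u (act M u)).re := by
  have h1 := hM fun i => (u i).re
  have h2 := hM fun i => (u i).im
  have e1 : (inner ℂ u (act M u)).re = ((fun i => (u i).re) ⬝ᵥ M.mulVec fun i => (u i).re) +
      ((fun i => (u i).im) ⬝ᵥ M.mulVec fun i => (u i).im) := by
    have : inner ℂ u (act M u) = ∑ i, inner ℂ (u i) (∑ j, (M i j : ℂ) * u j) := rfl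
    rw [this]
    simp only [dotProduct, Matrix.mulVec, Complex.re_sum, ← Finset.sum_add_distrib]
    refine Finset.sum_congr rfl fun i _ => ?_
    simp [Complex.mul_re, Complex.re_sum, Complex.im_sum, mul_comm]
  have e2 : ‖u‖ ^ 2 = ((fun i => (u i).re) ⬝ᵥ fun i => (u i).re) +
      ((fun i => (u i).im) ⬝ᵥ fun i => (u i).im) := by
    rw [EuclideanSpace.norm_sq_eq]
    simp only [dotProduct, ← Finset.sum_add_distrib]
    refine Finset.sum_congr rfl fun i _ => ?_
    rw [← Complex.normSq_eq_norm_sq, Complex.normSq_apply]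
  rw [e1, e2]
  linarith

/-- The state space `H`: the complexification `L²([a, b]; ℂ^d)` of `L²([a, b]; ℝ^d)`. This is a
type synonym which gets the norm `‖u‖_H = ‖ℋ^{1/2} u‖_{L²}` below, not the `L²` norm. -/
def Space : Type := Lp (EuclideanSpace ℂ (Fin d)) 2 S.μ

noncomputable instance : AddCommGroup S.Space :=
  inferInstanceAs (AddCommGroup (Lp (EuclideanSpace ℂ (Fin d)) 2 S.μ))

noncomputable instance : Module ℂ S.Space :=
  inferInstanceAs (Module ℂ (Lp (EuclideanSpace ℂ (Fin d)) 2 S.μ))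

/-- A representative of an element of `H`. -/
noncomputable def Space.toFun {S : PortHamiltonian d} (u : S.Space) :
    ℝ → EuclideanSpace ℂ (Fin d) :=
  ((show Lp (EuclideanSpace ℂ (Fin d)) 2 S.μ from u : Lp (EuclideanSpace ℂ (Fin d)) 2 S.μ) :
    ℝ → EuclideanSpace ℂ (Fin d))

variable {S} in
theorem Space.toFun_add (u v : S.Space) : (u + v).toFun =ᵐ[S.μ] fun x => u.toFun x + v.toFun x :=
  Lp.coeFn_add (E := EuclideanSpace ℂ (Fin d)) (p := 2) (μ := S.μ) u v

variable {S} in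
theorem Space.toFun_smul (r : ℂ) (u : S.Space) : (r • u).toFun =ᵐ[S.μ] fun x => r • u.toFun x :=
  Lp.coeFn_smul (E := EuclideanSpace ℂ (Fin d)) (p := 2) (μ := S.μ) r u

variable {S} in
theorem Space.toFun_zero : (0 : S.Space).toFun =ᵐ[S.μ] fun _ => 0 :=
  Lp.coeFn_zero (EuclideanSpace ℂ (Fin d)) 2 S.μ

variable {S} in
theorem Space.eq_zero_of_toFun {u : S.Space} (h : u.toFun =ᵐ[S.μ] fun _ => 0) : u = 0 :=
  (Lp.eq_zero_iff_ae_eq_zero (E := EuclideanSpace ℂ (Fin d)) (p := 2) (μ := S.μ)).2 h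

variable {S} in
theorem Space.integrable_inner (u v : S.Space) :
    Integrable (fun x => inner ℂ (u.toFun x) (act (S.ℋ x) (v.toFun x))) S.μ :=
  S.integrable_inner_aux u v

/-- The energy inner product `⟨u, v⟩_H = ∫ ⟨u, ℋ v⟩ = ∫ ⟨ℋ^{1/2} u, ℋ^{1/2} v⟩`. -/
@[reducible]
noncomputable def energyCore : InnerProductSpace.Core ℂ S.Space where
  inner u v := ∫ x, inner ℂ (u.toFun x) (act (S.ℋ x) (v.toFun x)) ∂S.μ
  conj_inner_symm u v := by
    rw [← integral_conj]
    refine integral_congr_ae ?_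
    filter_upwards [S.ℋ_symm] with x hx
    rw [inner_conj_symm, inner_act_symm hx]
  re_inner_nonneg u := by
    obtain ⟨k, hk, h⟩ := S.ℋ_lower
    rw [← integral_re (u.integrable_inner u)]
    refine integral_nonneg_of_ae ?_
    filter_upwards [h] with x hx
    exact le_trans (by positivity) (le_re_inner_act hx (u.toFun x))
  add_left u v w := by
    rw [← integral_add (u.integrable_inner w) (v.integrable_inner w)]
    refine integral_congr_ae ?_
    filter_upwards [u.toFun_add v] with x hx
    rw [hx, inner_add_left]
  smul_left u v r := by
    rw [← integral_const_mul]
    refine integral_congr_ae ?_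
    filter_upwards [u.toFun_smul r] with x hx
    rw [hx, inner_smul_left]
  definite u hu := by
    obtain ⟨k, hk, h⟩ := S.ℋ_lower
    have h0 : ∫ x, (inner ℂ (u.toFun x) (act (S.ℋ x) (u.toFun x))).re ∂S.μ = 0 := by
      have := integral_re (u.integrable_inner u)
      exact this.trans (by
        have h' := congrArg Complex.re hu
        exact h')
    have hpos : ∀ᵐ x ∂S.μ,
        k * ‖u.toFun x‖ ^ 2 ≤ (inner ℂ (u.toFun x) (act (S.ℋ x) (u.toFun x))).re := by
      filter_upwards [h] with x hx using le_re_inner_act hx _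
    have hz := (integral_eq_zero_iff_of_nonneg_ae (by
      filter_upwards [hpos] with x hx using le_trans (by positivity) hx)
      (u.integrable_inner u).re).1 h0
    refine Space.eq_zero_of_toFun ?_
    filter_upwards [hpos, hz] with x hx hx0
    have h1 : k * ‖u.toFun x‖ ^ 2 ≤ 0 := hx.trans (le_of_eq hx0)
    have h2 : ‖u.toFun x‖ ^ 2 ≤ 0 := by
      by_contra hcon
      push Not at hcon
      nlinarith [mul_pos hk hcon]
    exact norm_eq_zero.1 (pow_eq_zero_iff (two_ne_zero) |>.1 (le_antisymm h2 (sq_nonneg _)))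

/-- The norm `‖u‖_H = (∫ ⟨u, ℋ u⟩)^{1/2} = ‖ℋ^{1/2} u‖_{L²}`. -/
noncomputable instance : NormedAddCommGroup S.Space :=
  (S.energyCore).toNormedAddCommGroup

noncomputable instance : InnerProductSpace ℂ S.Space :=
  InnerProductSpace.ofCore S.energyCore.toCore

/-- `v ∈ H¹([a, b]; ℂ^d)` with weak derivative `g ∈ L²`; here `v` is the (absolutely) continuous
representative, so that `v a` and `v b` are the boundary traces. -/
def IsH1 (a b : ℝ) (v g : ℝ → EuclideanSpace ℂ (Fin d)) : Prop :=
  MemLp g 2 (volume.restrict (Icc a b)) ∧ ∀ x ∈ Icc a b, v x = v a + ∫ s in a..x, g s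

theorem IsH1.intervalIntegrable {a b : ℝ} (hab : a ≤ b) {v g : ℝ → EuclideanSpace ℂ (Fin d)}
    (h : IsH1 a b v g) : IntervalIntegrable g volume a b := by
  rw [intervalIntegrable_iff_integrableOn_Icc_of_le hab]
  exact h.1.integrable (by norm_num)

theorem IsH1.ae_eq_zero {a b : ℝ} (hab : a < b) {v g : ℝ → EuclideanSpace ℂ (Fin d)}
    (h : IsH1 a b v g) (hv : v =ᵐ[volume.restrict (Icc a b)] fun _ => 0) :
    g =ᵐ[volume.restrict (Icc a b)] fun _ => 0 := by
  have hg := h.intervalIntegrable hab.le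
  have hcont : ContinuousOn v (Icc a b) := by
    have h1 : ContinuousOn (fun x => v a + ∫ s in a..x, g s) (Icc a b) := by
      have := intervalIntegral.continuousOn_primitive_interval' hg left_mem_uIcc
      rw [uIcc_of_le hab.le] at this
      exact continuousOn_const.add this
    exact h1.congr h.2
  have hz : EqOn v (fun _ => 0) (Icc a b) :=
    Measure.eqOn_Icc_of_ae_eq volume hab.ne hv hcont continuousOn_const
  have hint : ∀ x ∈ Icc a b, ∫ s in a..x, g s = 0 := by
    intro x hx
    have := h.2 x hx
    rw [hz hx, hz (left_mem_Icc.2 hab.le)] at this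
    simpa using this.symm
  have hD := hg.ae_hasDerivAt_integral
  have ha : ∀ᵐ x : ℝ, x ≠ a := by simp [ae_iff, measure_singleton]
  have hb : ∀ᵐ x : ℝ, x ≠ b := by simp [ae_iff, measure_singleton]
  refine (ae_restrict_iff' measurableSet_Icc).2 ?_
  filter_upwards [hD, ha, hb] with x hx hxa hxb hxI
  have h1 := hx (by rwa [uIcc_of_le hab.le]) a left_mem_uIcc
  have hmem : Icc a b ∈ nhds x :=
    Icc_mem_nhds (lt_of_le_of_ne hxI.1 (Ne.symm hxa)) (lt_of_le_of_ne hxI.2 hxb)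
  have h2 : HasDerivAt (fun x => ∫ s in a..x, g s) 0 x := by
    refine (hasDerivAt_const x (0 : EuclideanSpace ℂ (Fin d))).congr_of_eventuallyEq ?_
    filter_upwards [hmem] with y hy using hint y hy
  exact h1.unique h2

/-- The graph of `𝒜`. A pair `(u, w)` lies in it iff `ℋ u` has a representative `v ∈ H¹` with
`W [v(b); v(a)] = 0` and `w = P₁ v' + P₀ v`. -/
def graph : Submodule ℂ (S.Space × S.Space) where
  carrier := {p | ∃ v g : ℝ → EuclideanSpace ℂ (Fin d),
    IsH1 S.a S.b v g ∧
    v =ᵐ[S.μ] (fun x => act (S.ℋ x) (p.1.toFun x)) ∧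
    (complexify S.W).mulVec (Sum.elim (v S.b) (v S.a)) = 0 ∧
    p.2.toFun =ᵐ[S.μ] fun x => act S.P₁ (g x) + act S.P₀ (v x)}
  zero_mem' := by
    refine ⟨fun _ => 0, fun _ => 0, ⟨MemLp.zero, fun x _ => by simp⟩, ?_, ?_, ?_⟩
    · filter_upwards [Space.toFun_zero (S := S)] with x hx
      simp [hx]
    · have : Sum.elim ((0 : EuclideanSpace ℂ (Fin d)) : Fin d → ℂ)
          ((0 : EuclideanSpace ℂ (Fin d)) : Fin d → ℂ) = 0 := by
        ext (i | i) <;> rfl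
      rw [this, Matrix.mulVec_zero]
    · filter_upwards [Space.toFun_zero (S := S)] with x hx
      simp [hx]
  add_mem' := by
    rintro ⟨u, w⟩ ⟨u', w'⟩ ⟨v, g, h1, h2, h3, h4⟩ ⟨v', g', h1', h2', h3', h4'⟩
    refine ⟨fun x => v x + v' x, fun x => g x + g' x, ⟨h1.1.add h1'.1, fun x hx => ?_⟩, ?_, ?_, ?_⟩
    · have hsub : uIcc S.a x ⊆ uIcc S.a S.b := by
        rw [uIcc_of_le hx.1, uIcc_of_le S.a_lt_b.le]
        exact Icc_subset_Icc_right hx.2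
      rw [intervalIntegral.integral_add
        ((h1.intervalIntegrable S.a_lt_b.le).mono_set hsub)
        ((h1'.intervalIntegrable S.a_lt_b.le).mono_set hsub)]
      change v x + v' x = _
      rw [h1.2 x hx, h1'.2 x hx]
      exact add_add_add_comm _ _ _ _
    · filter_upwards [u.toFun_add u', h2, h2'] with x hx k1 k2
      change v x + v' x = act (S.ℋ x) ((u + u').toFun x)
      rw [hx, map_add, k1, k2]
    · have : Sum.elim ((v S.b + v' S.b : EuclideanSpace ℂ (Fin d)) : Fin d → ℂ)
          ((v S.a + v' S.a : EuclideanSpace ℂ (Fin d)) : Fin d → ℂ) =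
          Sum.elim (v S.b) (v S.a) + Sum.elim (v' S.b) (v' S.a) := by
        ext (i | i) <;> rfl
      rw [this, Matrix.mulVec_add, h3, h3', add_zero]
    · filter_upwards [w.toFun_add w', h4, h4'] with x hx k1 k2
      change (w + w').toFun x = _
      rw [hx, map_add, map_add, k1, k2]
      abel
  smul_mem' := by
    rintro r ⟨u, w⟩ ⟨v, g, h1, h2, h3, h4⟩
    refine ⟨fun x => r • v x, fun x => r • g x, ⟨h1.1.const_smul r, fun x hx => ?_⟩, ?_, ?_, ?_⟩
    · rw [intervalIntegral.integral_smul]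
      change r • v x = _
      rw [h1.2 x hx, smul_add]
    · filter_upwards [u.toFun_smul r, h2] with x hx k1
      change r • v x = act (S.ℋ x) ((r • u).toFun x)
      rw [hx, map_smul, k1]
    · have : Sum.elim ((r • v S.b : EuclideanSpace ℂ (Fin d)) : Fin d → ℂ)
          ((r • v S.a : EuclideanSpace ℂ (Fin d)) : Fin d → ℂ) =
          r • Sum.elim (v S.b) (v S.a) := by
        ext (i | i) <;> rfl
      rw [this, Matrix.mulVec_smul, h3, smul_zero]
    · filter_upwards [w.toFun_smul r, h4] with x hx k1
      change (r • w).toFun x = _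
      rw [hx, map_smul, map_smul, k1, smul_add]

/-- The graph is single-valued, so that it is the graph of an operator. -/
theorem graph_functional (p : S.Space × S.Space) (hp : p ∈ S.graph) (h0 : p.1 = 0) :
    p.2 = 0 := by
  obtain ⟨v, g, h1, h2, -, h4⟩ := hp
  have hv : v =ᵐ[S.μ] fun _ => 0 := by
    filter_upwards [h2, Space.toFun_zero (S := S)] with x k1 k2
    rw [k1, h0, k2, map_zero]
  have hg := h1.ae_eq_zero S.a_lt_b hv
  refine Space.eq_zero_of_toFun ?_
  filter_upwards [h4, hv, hg] with x k1 k2 k3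
  rw [k1, k2, k3, map_zero, map_zero, add_zero]

/-- The port-Hamiltonian operator `𝒜 u = P₁ (ℋ u)' + P₀ ℋ u` with its domain. -/
noncomputable def 𝒜 : S.Space →ₗ.[ℂ] S.Space := S.graph.toLinearPMap

theorem graph_𝒜 : S.𝒜.graph = S.graph :=
  Submodule.toLinearPMap_graph_eq _ S.graph_functional

/-- `𝒜` is accretive on `H`. -/
def IsAccretive : Prop := ∀ u : S.𝒜.domain, 0 ≤ (inner ℂ (S.𝒜 u) (u : S.Space)).re

/-- Coefficient `-P₁⁻¹ (i t ℋ(x)⁻¹ + P₀)` of the ODE system. -/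
noncomputable def odeCoeff (t x : ℝ) : Matrix (Fin d) (Fin d) ℂ :=
  -((complexify S.P₁)⁻¹ *
    ((Complex.I * (t : ℂ)) • (complexify (S.ℋ x))⁻¹ + complexify S.P₀))

/-- `Φ` is a (Carathéodory) solution on `[a, b]` of `Φ' = -P₁⁻¹ (i t ℋ⁻¹ + P₀) Φ`, `Φ(a) = 1`. -/
def IsFundamentalMatrix (t : ℝ) (Φ : ℝ → Matrix (Fin d) (Fin d) ℂ) : Prop :=
  ContinuousOn Φ (Icc S.a S.b) ∧
    ∀ x ∈ Icc S.a S.b, Φ x = 1 + ∫ s in S.a..x, S.odeCoeff t s * Φ s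

theorem exists_norm_inv_le : ∃ c : ℝ, ∀ᵐ x ∂S.μ, ‖(complexify (S.ℋ x))⁻¹‖ ≤ c := by
  obtain ⟨k, hk, h⟩ := S.ℋ_lower
  refine ⟨k⁻¹, ?_⟩
  filter_upwards [h] with x hx
  have hlow : ∀ u : EuclideanSpace ℂ (Fin d), k * ‖u‖ ≤ ‖act (S.ℋ x) u‖ := by
    intro u
    rcases (norm_nonneg u).eq_or_lt' with h0 | h0
    · rw [h0, mul_zero]; exact norm_nonneg _
    · have h1 := le_re_inner_act hx u
      have h2 : (inner ℂ u (act (S.ℋ x) u)).re ≤ ‖u‖ * ‖act (S.ℋ x) u‖ :=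
        (Complex.re_le_norm _).trans (norm_inner_le_norm _ _)
      refine le_of_mul_le_mul_left ?_ h0
      calc ‖u‖ * (k * ‖u‖) = k * ‖u‖ ^ 2 := by ring
        _ ≤ _ := h1.trans h2
  have hunit : IsUnit (complexify (S.ℋ x)) := by
    rw [← Matrix.mulVec_injective_iff_isUnit]
    intro y z hyz
    have := hlow (WithLp.toLp 2 (y - z))
    have h0 : act (S.ℋ x) (WithLp.toLp 2 (y - z)) = 0 := by
      rw [act, Matrix.toEuclideanCLM_toLp, Matrix.mulVec_sub]
      change WithLp.toLp 2 ((complexify (S.ℋ x)).mulVec y - (complexify (S.ℋ x)).mulVec z) = 0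
      rw [show (complexify (S.ℋ x)).mulVec y = (complexify (S.ℋ x)).mulVec z from hyz]
      simp
    rw [h0, norm_zero] at this
    have h2 : ‖WithLp.toLp 2 (y - z)‖ ≤ 0 := by
      by_contra hcon
      push Not at hcon
      nlinarith [mul_pos hk hcon]
    have h3 := norm_le_zero_iff.1 h2
    have h4 : y - z = 0 := congrArg WithLp.ofLp h3
    exact sub_eq_zero.1 h4
  rw [Matrix.cstar_norm_def]
  refine ContinuousLinearMap.opNorm_le_bound _ (by positivity) fun f => ?_
  have h1 := hlow (Matrix.toEuclideanCLM (n := Fin d) (𝕜 := ℂ) (complexify (S.ℋ x))⁻¹ f)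
  have h2 : act (S.ℋ x) (Matrix.toEuclideanCLM (n := Fin d) (𝕜 := ℂ) (complexify (S.ℋ x))⁻¹ f)
      = f := by
    have : Matrix.toEuclideanCLM (n := Fin d) (𝕜 := ℂ) (complexify (S.ℋ x)) *
        Matrix.toEuclideanCLM (n := Fin d) (𝕜 := ℂ) (complexify (S.ℋ x))⁻¹ = 1 := by
      rw [← map_mul, Matrix.mul_nonsing_inv _ ((Matrix.isUnit_iff_isUnit_det _).1 hunit), map_one]
    exact congrArg (fun T => T f) this
  rw [h2] at h1
  rwa [inv_mul_eq_div, le_div_iff₀ hk, mul_comm]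

theorem aestronglyMeasurable_inv :
    AEStronglyMeasurable (fun x => (complexify (S.ℋ x))⁻¹) S.μ := by
  have h1 := aestronglyMeasurable_complexify S.ℋ_meas
  simp_rw [Matrix.inv_def, Ring.inverse_eq_inv]
  have hd : AEStronglyMeasurable (fun x => (complexify (S.ℋ x)).det⁻¹) S.μ := by
    have : AEStronglyMeasurable (fun x => (complexify (S.ℋ x)).det) S.μ :=
      (Continuous.matrix_det continuous_id).comp_aestronglyMeasurable h1
    exact this.aemeasurable.inv.aestronglyMeasurable
  have ha : AEStronglyMeasurable (fun x => (complexify (S.ℋ x)).adjugate) S.μ :=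
    (Continuous.matrix_adjugate continuous_id).comp_aestronglyMeasurable h1
  exact hd.smul ha

theorem exists_isFundamentalMatrix (t : ℝ) : ∃ Φ, S.IsFundamentalMatrix t Φ := by
  obtain ⟨c, hc⟩ := S.exists_norm_inv_le
  refine exists_linear_volterra_solution (S.odeCoeff t)
    (‖(complexify S.P₁)⁻¹‖ * (‖Complex.I * (t : ℂ)‖ * c + ‖complexify S.P₀‖)) ?_ ?_
  · exact ((((S.aestronglyMeasurable_inv.const_smul (Complex.I * (t : ℂ))).add
      aestronglyMeasurable_const).const_mul _).neg)
  · filter_upwards [hc] with x hx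
    rw [odeCoeff, norm_neg]
    refine (norm_mul_le _ _).trans ?_
    gcongr
    refine (norm_add_le _ _).trans ?_
    gcongr
    rw [norm_smul]
    gcongr

/-- The fundamental matrix `Φ_t`. It is unique on `[a, b]`; its values elsewhere play no role. -/
noncomputable def Φ (t : ℝ) : ℝ → Matrix (Fin d) (Fin d) ℂ :=
  (S.exists_isFundamentalMatrix t).choose

theorem isFundamentalMatrix_Φ (t : ℝ) : S.IsFundamentalMatrix t (S.Φ t) :=
  (S.exists_isFundamentalMatrix t).choose_spec

/-- `B_t = ‖Φ_t‖_∞`, the sup norm over `[a, b]`. -/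
noncomputable def Bt (t : ℝ) : ENNReal := ⨆ x ∈ Icc S.a S.b, ‖S.Φ t x‖ₑ

/-- Condition (B): `B = sup_t B_t < ∞`. -/
def ConditionB : Prop := ⨆ t : ℝ, S.Bt t < ⊤

/-- `T_t = W [Φ_t(b); 1]`. -/
noncomputable def T (t : ℝ) : Matrix (Fin d) (Fin d) ℂ :=
  complexify S.W * Matrix.fromRows (S.Φ t S.b) 1

/-- `m(η) = sup_{|t| ≤ η} ‖T_t⁻¹‖` (spectral norm). -/
noncomputable def m (η : ℝ) : ℝ := sSup ((fun t => ‖(S.T t)⁻¹‖) '' Icc (-η) η)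

end PortHamiltonian

namespace LinearPMap

variable {E : Type*} [NormedAddCommGroup E] [NormedSpace ℂ E]

/-- `R` is a bounded two-sided inverse of `z - A : dom A → E`. -/
def IsResolventAt (A : E →ₗ.[ℂ] E) (z : ℂ) (R : E →L[ℂ] E) : Prop :=
  (∀ f : E, ∃ h : R f ∈ A.domain, z • R f - A ⟨R f, h⟩ = f) ∧
    ∀ u : A.domain, R (z • (u : E) - A u) = u

/-- The resolvent set `ρ(A)`. -/
def resolventSet (A : E →ₗ.[ℂ] E) : Set ℂ := {z | ∃ R, A.IsResolventAt z R}

open Classical in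
/-- `R(z, A) = (z - A)⁻¹` for `z ∈ ρ(A)` (and `0` otherwise). -/
noncomputable def resolvent (A : E →ₗ.[ℂ] E) (z : ℂ) : E →L[ℂ] E :=
  if h : ∃ R, A.IsResolventAt z R then h.choose else 0

/-- The function `M(η) = sup_{|t| ≤ η} ‖R(it, A)‖`. -/
noncomputable def resolventGrowth (A : E →ₗ.[ℂ] E) (η : ℝ) : ℝ :=
  sSup ((fun t : ℝ => ‖A.resolvent (Complex.I * (t : ℂ))‖) '' Icc (-η) η)

end LinearPMap

/-! Substituting $v=\mathcal Hu$ turns $(\mathrm it+\mathcal A)u=f$ into the boundary value problem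
$\mathrm it\mathcal H^{-1}v+P_1v'+P_0v=f$, $W[v(b);v(a)]=0$. Both inequalities compare its solutions
with the homogeneous ones $\Phi_t w$.

The basic tool is an energy identity. Since $P_1$ and $\mathcal H^{-1}$ are symmetric and $P_0$ is
skew, pairing $\Phi_t w$ with a solution $v$ gives $\langle\Phi_t w,P_1v\rangle'=\langle\Phi_t
w,f\rangle$ (`IsSolution.inner_flow`). For $f=0$ this says $\Phi_t^*P_1\Phi_t=P_1$, so condition (B)
also bounds $\Phi_t(x)^{-1}$ uniformly. For general $f$ it yields $|v(x)-\Phi_t(x)v(a)|\le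
C\|f\|_{L^1}$ with $C$ independent of $t$.

Resolvent from $T_t^{-1}$ (`exists_norm_res_le`): the boundary condition and this estimate give
$|T_tv(a)|\le C\|f\|$. Hence $v(a)$, and then $v$ and $u$, are bounded by $(\|T_t^{-1}\|+1)\|f\|$.

$T_t^{-1}$ from the resolvent (`exists_norm_le_T`): given $y$, the curve $\Phi_ty$ misses the
boundary condition by $T_ty$. A correction of size $O(|T_ty|)$ repairs it and produces an element of
the domain whose image under $\mathrm it+\mathcal A$ is also $O(|T_ty|)$. The resolvent bounds this
element, from which $y$ is recovered, so $|y|\le C(\|R\|+1)|T_ty|$. Invertibility of $T_t$ follows.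

The additive constants are absorbed because $\|T_t^{-1}\|$ is bounded below and the resolvent at
$t=0$ is nonzero. Finiteness of the suprema comes from the resolvent identity and compactness. -/

section Primitive

/-! ### Primitives of integrable functions and the product rule -/

variable {E F G : Type*} [NormedAddCommGroup E] [NormedSpace ℝ E] [NormedAddCommGroup F]
  [NormedSpace ℝ F] [NormedAddCommGroup G] [NormedSpace ℝ G]

/-- A function whose increments are dominated by those of an absolutely continuous real function
is absolutely continuous. -/
theorem AbsolutelyContinuousOnInterval.of_dist_le {X Y : Type*} [PseudoMetricSpace X]
    [PseudoMetricSpace Y] {f : ℝ → X} {n : ℝ → Y} {a b : ℝ}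
    (hn : AbsolutelyContinuousOnInterval n a b)
    (h : ∀ x ∈ uIcc a b, ∀ y ∈ uIcc a b, dist (f x) (f y) ≤ dist (n x) (n y)) :
    AbsolutelyContinuousOnInterval f a b := by
  rw [absolutelyContinuousOnInterval_iff] at hn ⊢
  intro ε hε
  obtain ⟨δ, hδ, H⟩ := hn ε hε
  refine ⟨δ, hδ, fun I hI hlt => lt_of_le_of_lt (Finset.sum_le_sum fun i hi => ?_) (H I hI hlt)⟩
  exact h _ (hI.1 i hi).1 _ (hI.1 i hi).2

theorem IntervalIntegrable.mono_Icc {X : Type*} [NormedAddCommGroup X] {f : ℝ → X} {a b : ℝ} (hab : a ≤ b)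
    (hf : IntervalIntegrable f volume a b) {x y : ℝ} (hx : a ≤ x) (hxy : x ≤ y) (hy : y ≤ b) :
    IntervalIntegrable f volume x y := by
  refine hf.mono_set ?_
  rw [uIcc_of_le hxy, uIcc_of_le hab]
  exact Icc_subset_Icc hx hy

/-- The fundamental theorem of calculus for an almost everywhere differentiable function whose
increments are dominated by the integrals of an integrable function. -/
theorem eq_add_integral_of_norm_sub_le [CompleteSpace E] {h h' : ℝ → E} {n : ℝ → ℝ} {a b : ℝ}
    (hab : a ≤ b)
    (hn : IntervalIntegrable n volume a b) (hh' : IntervalIntegrable h' volume a b)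
    (hle : ∀ x y, a ≤ x → x ≤ y → y ≤ b → ‖h y - h x‖ ≤ ∫ s in x..y, n s)
    (hd : ∀ᵐ x, x ∈ uIcc a b → HasDerivAt h (h' x) x) :
    ∀ x ∈ Icc a b, h x = h a + ∫ s in a..x, h' s := by
  have hnn := hn.add hh'.norm
  have hac := hnn.absolutelyContinuousOnInterval_intervalIntegral (c := a) left_mem_uIcc
  -- The difference `h - ∫ h'` has increments dominated by those of `∫ (n + ‖h'‖)`, so it is
  -- absolutely continuous. Its derivative vanishes almost everywhere, so it is constant.
  have hk : AbsolutelyContinuousOnInterval (fun x => h x - ∫ s in a..x, h' s) a b := by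
    refine hac.of_dist_le ?_
    have key : ∀ x y, a ≤ x → x ≤ y → y ≤ b →
        dist (h x - ∫ s in a..x, h' s) (h y - ∫ s in a..y, h' s) ≤
        dist (∫ s in a..x, (n s + ‖h' s‖)) (∫ s in a..y, (n s + ‖h' s‖)) := by
      intro x y h1 h2 h3
      have i1 := hh'.mono_Icc hab le_rfl h1 (h2.trans h3)
      have i2 := hh'.mono_Icc hab le_rfl (h1.trans h2) h3
      have j1 := hnn.mono_Icc hab le_rfl h1 (h2.trans h3)
      have j2 := hnn.mono_Icc hab le_rfl (h1.trans h2) h3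
      rw [dist_comm, dist_comm (∫ s in a..x, _), dist_eq_norm, Real.dist_eq]
      have e1 : (h y - ∫ s in a..y, h' s) - (h x - ∫ s in a..x, h' s) =
          (h y - h x) - ∫ s in x..y, h' s := by
        rw [← intervalIntegral.integral_interval_sub_left i2 i1]; abel
      rw [e1, intervalIntegral.integral_interval_sub_left j2 j1,
        intervalIntegral.integral_add (hn.mono_Icc hab h1 h2 h3) (hh'.norm.mono_Icc hab h1 h2 h3)]
      refine le_trans ?_ (le_abs_self _)
      exact (norm_sub_le _ _).trans (add_le_add (hle x y h1 h2 h3)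
        (intervalIntegral.norm_integral_le_integral_norm h2))
    intro x hx y hy
    rw [uIcc_of_le hab] at hx hy
    rcases le_total x y with hxy | hxy
    · exact key x y hx.1 hxy hy.2
    · rw [dist_comm, dist_comm (∫ s in a..x, _)]
      exact key y x hy.1 hxy hx.2
  have hz : ∀ᵐ x, x ∈ uIcc a b → HasDerivAt (fun x => h x - ∫ s in a..x, h' s) 0 x := by
    filter_upwards [hd, hh'.ae_hasDerivAt_integral] with x h1 h2 hx
    have := (h1 hx).fun_sub (h2 hx a left_mem_uIcc)
    rwa [sub_self] at this
  obtain ⟨C, hC⟩ := hk.const_of_ae_hasDerivAt_zero hz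
  intro x hx
  have e1 := hC x (by rwa [uIcc_of_le hab])
  have e2 := hC a left_mem_uIcc
  simp only [intervalIntegral.integral_same, sub_zero] at e2
  rw [e2, ← e1]
  abel

/-- `F` is a primitive of the integrable function `f` on `[a, b]`. -/
def IsPrimitiveOn (a b : ℝ) (F f : ℝ → E) : Prop :=
  IntervalIntegrable f volume a b ∧ ∀ x ∈ Icc a b, F x = F a + ∫ s in a..x, f s

namespace IsPrimitiveOn

variable {a b : ℝ} {u u' : ℝ → E} {v v' : ℝ → F}

theorem intervalIntegrable (hab : a ≤ b) (hu : IsPrimitiveOn a b u u') {x y : ℝ} (hx : a ≤ x)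
    (hxy : x ≤ y) (hy : y ≤ b) : IntervalIntegrable u' volume x y :=
  hu.1.mono_Icc hab hx hxy hy

theorem sub_eq (hab : a ≤ b) (hu : IsPrimitiveOn a b u u') {x y : ℝ} (hx : a ≤ x)
    (hxy : x ≤ y) (hy : y ≤ b) : u y - u x = ∫ s in x..y, u' s := by
  rw [hu.2 y ⟨hx.trans hxy, hy⟩, hu.2 x ⟨hx, hxy.trans hy⟩,
    ← intervalIntegral.integral_interval_sub_left
      (hu.intervalIntegrable hab le_rfl (hx.trans hxy) hy)
      (hu.intervalIntegrable hab le_rfl hx (hxy.trans hy))]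
  abel

theorem continuousOn (hab : a ≤ b) (hu : IsPrimitiveOn a b u u') : ContinuousOn u (Icc a b) := by
  have h1 : ContinuousOn (fun x => u a + ∫ s in a..x, u' s) (Icc a b) := by
    have := intervalIntegral.continuousOn_primitive_interval' hu.1 left_mem_uIcc
    rw [uIcc_of_le hab] at this
    exact continuousOn_const.add this
  exact h1.congr hu.2

theorem ae_hasDerivAt [CompleteSpace E] (hab : a ≤ b) (hu : IsPrimitiveOn a b u u') :
    ∀ᵐ x, x ∈ uIcc a b → HasDerivAt u (u' x) x := by
  have ha : ∀ᵐ x : ℝ, x ≠ a := by simp [ae_iff, measure_singleton]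
  have hb : ∀ᵐ x : ℝ, x ≠ b := by simp [ae_iff, measure_singleton]
  filter_upwards [hu.1.ae_hasDerivAt_integral, ha, hb] with x hx hxa hxb hxI
  have h1 := (hx hxI a left_mem_uIcc).const_add (u a)
  rw [uIcc_of_le hab] at hxI
  have hmem : Icc a b ∈ nhds x :=
    Icc_mem_nhds (lt_of_le_of_ne hxI.1 (Ne.symm hxa)) (lt_of_le_of_ne hxI.2 hxb)
  refine h1.congr_of_eventuallyEq ?_
  filter_upwards [hmem] with y hy using hu.2 y hy

/-- The product rule for primitives of integrable functions. -/
theorem bilinear [CompleteSpace E] [CompleteSpace F] [CompleteSpace G] (hab : a ≤ b)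
    (B : E →L[ℝ] F →L[ℝ] G) (hu : IsPrimitiveOn a b u u') (hv : IsPrimitiveOn a b v v') :
    IsPrimitiveOn a b (fun x => B (u x) (v x)) (fun x => B (u x) (v' x) + B (u' x) (v x)) := by
  have hcu := hu.continuousOn hab
  have hcv := hv.continuousOn hab
  obtain ⟨Cu, hCu⟩ := isCompact_Icc.exists_bound_of_continuousOn hcu
  obtain ⟨Cv, hCv⟩ := isCompact_Icc.exists_bound_of_continuousOn hcv
  have i1 : IntervalIntegrable (fun x => B (u x) (v' x)) volume a b := by
    refine (hv.1.norm.const_mul (‖B‖ * Cu)).mono_fun ?_ ?_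
    · have h1 : AEStronglyMeasurable u (volume.restrict (uIoc a b)) := by
        rw [uIoc_of_le hab]
        exact (hcu.mono Ioc_subset_Icc_self).aestronglyMeasurable measurableSet_Ioc
      exact B.aestronglyMeasurable_comp₂ h1 hv.1.def'.aestronglyMeasurable
    · refine (ae_restrict_iff' measurableSet_uIoc).2 (Filter.Eventually.of_forall fun x hx => ?_)
      rw [uIoc_of_le hab] at hx
      refine (B.le_opNorm₂ _ _).trans (le_trans ?_ (le_abs_self _))
      have := hCu x ⟨hx.1.le, hx.2⟩
      gcongr
  have i2 : IntervalIntegrable (fun x => B (u' x) (v x)) volume a b := by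
    refine (hu.1.norm.const_mul (‖B‖ * Cv)).mono_fun ?_ ?_
    · have h1 : AEStronglyMeasurable v (volume.restrict (uIoc a b)) := by
        rw [uIoc_of_le hab]
        exact (hcv.mono Ioc_subset_Icc_self).aestronglyMeasurable measurableSet_Ioc
      exact B.aestronglyMeasurable_comp₂ hu.1.def'.aestronglyMeasurable h1
    · refine (ae_restrict_iff' measurableSet_uIoc).2 (Filter.Eventually.of_forall fun x hx => ?_)
      rw [uIoc_of_le hab] at hx
      refine (B.le_opNorm₂ _ _).trans (le_trans ?_ (le_abs_self _))
      have := hCv x ⟨hx.1.le, hx.2⟩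
      calc ‖B‖ * ‖u' x‖ * ‖v x‖ ≤ ‖B‖ * ‖u' x‖ * Cv := by gcongr
        _ = ‖B‖ * Cv * ‖u' x‖ := by ring
  -- The dominating density comes from splitting the increment as `B (u y) (v y - v x) + B (u y - u
  -- x) (v x)` and using the sup bounds `Cu` and `Cv`.
  refine ⟨i1.add i2, eq_add_integral_of_norm_sub_le hab
    (n := fun s => ‖B‖ * Cu * ‖v' s‖ + ‖B‖ * Cv * ‖u' s‖)
    ((hv.1.norm.const_mul _).add (hu.1.norm.const_mul _)) (i1.add i2) ?_ ?_⟩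
  · intro x y hx hxy hy
    have e : B (u y) (v y) - B (u x) (v x) = B (u y) (v y - v x) + B (u y - u x) (v x) := by
      simp
    rw [e, intervalIntegral.integral_add
      ((hv.intervalIntegrable hab hx hxy hy).norm.const_mul _)
      ((hu.intervalIntegrable hab hx hxy hy).norm.const_mul _),
      intervalIntegral.integral_const_mul, intervalIntegral.integral_const_mul]
    have b1 : ‖v y - v x‖ ≤ ∫ s in x..y, ‖v' s‖ := by
      rw [hv.sub_eq hab hx hxy hy]
      exact intervalIntegral.norm_integral_le_integral_norm hxy
    have b2 : ‖u y - u x‖ ≤ ∫ s in x..y, ‖u' s‖ := by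
      rw [hu.sub_eq hab hx hxy hy]
      exact intervalIntegral.norm_integral_le_integral_norm hxy
    have c1 := hCu y ⟨hx.trans hxy, hy⟩
    have c2 := hCv x ⟨hx, hxy.trans hy⟩
    have c1' := (norm_nonneg _).trans c1
    refine (norm_add_le _ _).trans (add_le_add ?_ ?_)
    · refine (B.le_opNorm₂ _ _).trans ?_
      gcongr
    · refine (B.le_opNorm₂ _ _).trans ?_
      have c3 := (norm_nonneg _).trans b2
      calc ‖B‖ * ‖u y - u x‖ * ‖v x‖ ≤ ‖B‖ * (∫ s in x..y, ‖u' s‖) * Cv := by gcongr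
        _ = _ := by ring
  · filter_upwards [hu.ae_hasDerivAt hab, hv.ae_hasDerivAt hab] with x h1 h2 hx
    exact B.hasDerivAt_of_bilinear (fun _ => h1 hx) (fun _ => h2 hx)

theorem clm_apply [CompleteSpace E] [CompleteSpace F] (hu : IsPrimitiveOn a b u u')
    (L : E →L[ℝ] F) (hab : a ≤ b) : IsPrimitiveOn a b (fun x => L (u x)) (fun x => L (u' x)) := by
  refine ⟨⟨L.integrable_comp hu.1.1, L.integrable_comp hu.1.2⟩, fun x hx => ?_⟩
  change L (u x) = L (u a) + ∫ s in a..x, L (u' s)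
  rw [hu.2 x hx, map_add,
    L.intervalIntegral_comp_comm (hu.intervalIntegrable hab le_rfl hx.1 hx.2)]

end IsPrimitiveOn

end Primitive

/-! ### The fundamental matrix and its energy identity -/

namespace PortHamiltonian

variable {d : ℕ} (S : PortHamiltonian d)

/-- The fundamental matrix as an operator on `ℂ^d`. -/
noncomputable def flow (t x : ℝ) : EuclideanSpace ℂ (Fin d) →L[ℂ] EuclideanSpace ℂ (Fin d) :=
  Matrix.toEuclideanCLM (n := Fin d) (𝕜 := ℂ) (S.Φ t x)

/-- The inverse of `P₁` as an operator on `ℂ^d`. -/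
noncomputable def P₁inv : EuclideanSpace ℂ (Fin d) →L[ℂ] EuclideanSpace ℂ (Fin d) :=
  Matrix.toEuclideanCLM (n := Fin d) (𝕜 := ℂ) (complexify S.P₁)⁻¹

/-- The inverse of the Hamiltonian density as an operator on `ℂ^d`. -/
noncomputable def invDensity (x : ℝ) :
    EuclideanSpace ℂ (Fin d) →L[ℂ] EuclideanSpace ℂ (Fin d) :=
  Matrix.toEuclideanCLM (n := Fin d) (𝕜 := ℂ) (complexify (S.ℋ x))⁻¹

theorem toEuclideanCLM_inv_apply {M : Matrix (Fin d) (Fin d) ℂ} (hM : IsUnit M)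
    (y : EuclideanSpace ℂ (Fin d)) :
    Matrix.toEuclideanCLM (n := Fin d) (𝕜 := ℂ) M⁻¹
      (Matrix.toEuclideanCLM (n := Fin d) (𝕜 := ℂ) M y) = y ∧
    Matrix.toEuclideanCLM (n := Fin d) (𝕜 := ℂ) M
      (Matrix.toEuclideanCLM (n := Fin d) (𝕜 := ℂ) M⁻¹ y) = y := by
  have hd := (Matrix.isUnit_iff_isUnit_det _).1 hM
  have h1 : Matrix.toEuclideanCLM (n := Fin d) (𝕜 := ℂ) M⁻¹ *
      Matrix.toEuclideanCLM (n := Fin d) (𝕜 := ℂ) M = 1 := by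
    rw [← map_mul, Matrix.nonsing_inv_mul _ hd, map_one]
  have h2 : Matrix.toEuclideanCLM (n := Fin d) (𝕜 := ℂ) M *
      Matrix.toEuclideanCLM (n := Fin d) (𝕜 := ℂ) M⁻¹ = 1 := by
    rw [← map_mul, Matrix.mul_nonsing_inv _ hd, map_one]
  exact ⟨congrArg (fun T => T y) h1, congrArg (fun T => T y) h2⟩

theorem isUnit_complexify {M : Matrix (Fin d) (Fin d) ℝ} (hM : IsUnit M) :
    IsUnit (complexify M) :=
  hM.map (Complex.ofRealHom.mapMatrix (m := Fin d))

theorem P₁inv_act (y : EuclideanSpace ℂ (Fin d)) : S.P₁inv (act S.P₁ y) = y :=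
  (toEuclideanCLM_inv_apply (isUnit_complexify S.P₁_isUnit) y).1

theorem act_P₁inv (y : EuclideanSpace ℂ (Fin d)) : act S.P₁ (S.P₁inv y) = y :=
  (toEuclideanCLM_inv_apply (isUnit_complexify S.P₁_isUnit) y).2

theorem isUnit_of_pos {M : Matrix (Fin d) (Fin d) ℝ} {k : ℝ} (hk : 0 < k)
    (hM : ∀ ξ : Fin d → ℝ, k * (ξ ⬝ᵥ ξ) ≤ ξ ⬝ᵥ M.mulVec ξ) : IsUnit M := by
  rw [← Matrix.mulVec_injective_iff_isUnit]
  intro y z hyz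
  have h := hM (y - z)
  rw [Matrix.mulVec_sub, show M.mulVec y = M.mulVec z from hyz, sub_self, dotProduct_zero] at h
  have h1 : (y - z) ⬝ᵥ (y - z) = 0 :=
    le_antisymm (nonpos_of_mul_nonpos_right h hk) (Finset.sum_nonneg fun i _ => mul_self_nonneg _)
  exact sub_eq_zero.1 (dotProduct_self_eq_zero.1 h1)

theorem ae_invDensity : ∀ᵐ x ∂S.μ,
    (∀ y, S.invDensity x (act (S.ℋ x) y) = y) ∧ (∀ y, act (S.ℋ x) (S.invDensity x y) = y) ∧
    ∀ y z, inner ℂ (S.invDensity x y) z = inner ℂ y (S.invDensity x z) := by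
  obtain ⟨k, hk, h⟩ := S.ℋ_lower
  filter_upwards [h, S.ℋ_symm] with x hx hs
  have hu := isUnit_complexify (isUnit_of_pos hk hx)
  have h1 : ∀ y, S.invDensity x (act (S.ℋ x) y) = y := fun y => (toEuclideanCLM_inv_apply hu y).1
  have h2 : ∀ y, act (S.ℋ x) (S.invDensity x y) = y := fun y => (toEuclideanCLM_inv_apply hu y).2
  refine ⟨h1, h2, fun y z => ?_⟩
  conv_lhs => rw [← h2 z]
  rw [← inner_act_symm hs, h2]

theorem inner_act_P₀ (y z : EuclideanSpace ℂ (Fin d)) :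
    inner ℂ (act S.P₀ y) z = -inner ℂ y (act S.P₀ z) := by
  have h : ContinuousLinearMap.adjoint (act S.P₀) = -act S.P₀ := by
    have := map_star (Matrix.toEuclideanCLM (n := Fin d) (𝕜 := ℂ)) (complexify S.P₀)
    rw [ContinuousLinearMap.star_eq_adjoint] at this
    rw [act, ← this, ← map_neg]
    congr 1
    ext i j
    have h2 : S.P₀ j i = -S.P₀ i j := congrFun (congrFun S.P₀_skew i) j
    simp [h2]
  rw [← ContinuousLinearMap.adjoint_inner_right, h]
  simp

/-- The coefficient of the ODE system as an operator on `ℂ^d`. -/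
noncomputable def odeOp (t x : ℝ) : EuclideanSpace ℂ (Fin d) →L[ℂ] EuclideanSpace ℂ (Fin d) :=
  Matrix.toEuclideanCLM (n := Fin d) (𝕜 := ℂ) (S.odeCoeff t x)

theorem odeOp_apply (t x : ℝ) (y : EuclideanSpace ℂ (Fin d)) : S.odeOp t x y =
    -S.P₁inv ((Complex.I * t) • S.invDensity x y + act S.P₀ y) := by
  rw [odeOp, odeCoeff, map_neg, map_mul, map_add, map_smul]
  rfl

theorem intervalIntegrable_odeCoeff_mul (t : ℝ) :
    IntervalIntegrable (fun s => S.odeCoeff t s * S.Φ t s) volume S.a S.b := by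
  obtain ⟨c, hc⟩ := S.exists_norm_inv_le
  have hm : AEStronglyMeasurable (S.odeCoeff t) S.μ :=
    (((S.aestronglyMeasurable_inv.const_smul (Complex.I * (t : ℂ))).add
      aestronglyMeasurable_const).const_mul _).neg
  have h1 : IntervalIntegrable (S.odeCoeff t) volume S.a S.b := by
    rw [intervalIntegrable_iff_integrableOn_Icc_of_le S.a_lt_b.le]
    refine Integrable.of_bound hm
      (‖(complexify S.P₁)⁻¹‖ * (‖Complex.I * (t : ℂ)‖ * c + ‖complexify S.P₀‖)) ?_
    filter_upwards [hc] with x hx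
    rw [odeCoeff, norm_neg]
    refine (norm_mul_le _ _).trans ?_
    gcongr
    refine (norm_add_le _ _).trans ?_
    gcongr
    rw [norm_smul]
    gcongr
  refine h1.mul_continuousOn ?_
  rw [uIcc_of_le S.a_lt_b.le]
  exact (S.isFundamentalMatrix_Φ t).1

theorem flow_left (t : ℝ) : S.flow t S.a = 1 := by
  have := (S.isFundamentalMatrix_Φ t).2 S.a (left_mem_Icc.2 S.a_lt_b.le)
  rw [intervalIntegral.integral_same, add_zero] at this
  rw [flow, this, map_one]

theorem isPrimitiveOn_flow (t : ℝ) :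
    IsPrimitiveOn S.a S.b (S.flow t) (fun s => S.odeOp t s * S.flow t s) := by
  have h : IsPrimitiveOn S.a S.b (S.Φ t) (fun s => S.odeCoeff t s * S.Φ t s) := by
    refine ⟨S.intervalIntegrable_odeCoeff_mul t, fun x hx => ?_⟩
    have h1 := (S.isFundamentalMatrix_Φ t).2 S.a (left_mem_Icc.2 S.a_lt_b.le)
    rw [intervalIntegral.integral_same, add_zero] at h1
    rw [h1]
    exact (S.isFundamentalMatrix_Φ t).2 x hx
  have h2 := h.clm_apply (LinearMap.toContinuousLinearMap
    ((LinearMapClass.linearMap (Matrix.toEuclideanCLM (n := Fin d) (𝕜 := ℂ))).restrictScalars ℝ))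
    S.a_lt_b.le
  have e : (fun s => S.odeOp t s * S.flow t s) = fun s =>
      Matrix.toEuclideanCLM (n := Fin d) (𝕜 := ℂ) (S.odeCoeff t s * S.Φ t s) := by
    ext1 s
    rw [map_mul]
    rfl
  rw [e]
  exact h2

theorem isPrimitiveOn_flow_apply (t : ℝ) {v g : ℝ → EuclideanSpace ℂ (Fin d)}
    (hv : IsPrimitiveOn S.a S.b v g) :
    IsPrimitiveOn S.a S.b (fun x => S.flow t x (v x))
      (fun s => S.flow t s (g s) + S.odeOp t s (S.flow t s (v s))) :=
  (S.isPrimitiveOn_flow t).bilinear S.a_lt_b.le (ContinuousLinearMap.restrictScalarsL ℂ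
    (EuclideanSpace ℂ (Fin d)) (EuclideanSpace ℂ (Fin d)) ℝ ℝ) hv

theorem isPrimitiveOn_const {E : Type*} [NormedAddCommGroup E] [NormedSpace ℝ E] (a b : ℝ)
    (w : E) : IsPrimitiveOn a b (fun _ => w) (fun _ => 0) :=
  ⟨intervalIntegrable_const, fun x _ => by simp⟩

theorem isPrimitiveOn_flow_const (t : ℝ) (w : EuclideanSpace ℂ (Fin d)) :
    IsPrimitiveOn S.a S.b (fun x => S.flow t x w) (fun s => S.odeOp t s (S.flow t s w)) := by
  simpa using S.isPrimitiveOn_flow_apply t (isPrimitiveOn_const S.a S.b w)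

/-- `v` solves `i t ℋ⁻¹ v + P₁ v' + P₀ v = f`. -/
structure IsSolution (t : ℝ) (v f : ℝ → EuclideanSpace ℂ (Fin d)) : Prop where
  integrable : IntervalIntegrable f volume S.a S.b
  exists_primitive : ∃ g, IsPrimitiveOn S.a S.b v g ∧ ∀ᵐ x ∂S.μ,
    (Complex.I * t) • S.invDensity x (v x) + act S.P₁ (g x) + act S.P₀ (v x) = f x

/-- Symmetry of `P₁` cancels the factor `P₁⁻¹` in the coefficient. What remains, `i t ℋ⁻¹ + P₀`, is
skew-adjoint, so moving it to the other side of the inner product absorbs the minus sign. -/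
theorem inner_odeOp (t : ℝ) : ∀ᵐ x ∂S.μ, ∀ y v g : EuclideanSpace ℂ (Fin d),
    inner ℂ y (act S.P₁ g) + inner ℂ (S.odeOp t x y) (act S.P₁ v) =
    inner ℂ y ((Complex.I * t) • S.invDensity x v + act S.P₁ g + act S.P₀ v) := by
  filter_upwards [S.ae_invDensity] with x hx y v g
  rw [odeOp_apply, inner_neg_left, ← inner_act_symm S.P₁_symm (S.P₁inv _), act_P₁inv, inner_add_left,
    inner_smul_left, inner_act_P₀, hx.2.2]
  simp only [inner_add_right, inner_smul_right, map_mul, Complex.conj_I, Complex.conj_ofReal]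
  ring

variable {S} in
-- Variation of constants in weak form: testing against homogeneous solutions removes every
-- coefficient of the equation, and the inverse of the fundamental matrix does not appear.
theorem IsSolution.inner_flow {t : ℝ} {v f : ℝ → EuclideanSpace ℂ (Fin d)}
    (h : S.IsSolution t v f) (w : EuclideanSpace ℂ (Fin d)) {x : ℝ} (hx : x ∈ Icc S.a S.b) :
    inner ℂ (S.flow t x w) (act S.P₁ (v x)) =
      inner ℂ w (act S.P₁ (v S.a)) + ∫ s in S.a..x, inner ℂ (S.flow t s w) (f s) := by
  obtain ⟨g, hv, hg⟩ := h.exists_primitive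
  have h1 := hv.clm_apply ((act S.P₁).restrictScalars ℝ) S.a_lt_b.le
  -- The complex inner product is conjugate linear on the left, so the product rule is applied to it
  -- as a real bilinear map.
  have h2 := ((S.isPrimitiveOn_flow_const t w).bilinear S.a_lt_b.le
    (isBoundedBilinearMap_inner (𝕜 := ℂ)
      (E := EuclideanSpace ℂ (Fin d))).toContinuousLinearMap h1).2 x hx
  have h3 : S.flow t S.a w = w := by rw [flow_left]; rfl
  refine h2.trans ?_
  change inner ℂ (S.flow t S.a w) (act S.P₁ (v S.a)) + ∫ s in S.a..x,
    (inner ℂ (S.flow t s w) (act S.P₁ (g s)) +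
      inner ℂ (S.odeOp t s (S.flow t s w)) (act S.P₁ (v s))) = _
  rw [h3]
  congr 1
  refine intervalIntegral.integral_congr_ae ?_
  have h4 := (ae_restrict_iff' measurableSet_Icc).1 (S.inner_odeOp t)
  have h5 := (ae_restrict_iff' measurableSet_Icc).1 hg
  filter_upwards [h4, h5] with s h4 h5 hs
  rw [uIoc_of_le hx.1] at hs
  have hs' : s ∈ Icc S.a S.b := ⟨hs.1.le, hs.2.trans hx.2⟩
  rw [h4 hs', h5 hs']

theorem isSolution_flow (t : ℝ) (w : EuclideanSpace ℂ (Fin d)) :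
    S.IsSolution t (fun x => S.flow t x w) (fun _ => 0) := by
  refine ⟨intervalIntegrable_const, _, S.isPrimitiveOn_flow_const t w,
    Filter.Eventually.of_forall fun x => ?_⟩
  rw [odeOp_apply, map_neg, act_P₁inv]
  abel

/-- This is $\Phi_t^*P_1\Phi_t=P_1$, the energy identity without forcing. It provides the inverse
$P_1^{-1}\Phi_t^*P_1$, whose size is controlled by that of $\Phi_t$. -/
theorem inner_flow_flow (t : ℝ) (w w' : EuclideanSpace ℂ (Fin d)) {x : ℝ}
    (hx : x ∈ Icc S.a S.b) :
    inner ℂ (S.flow t x w) (act S.P₁ (S.flow t x w')) = inner ℂ w (act S.P₁ w') := by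
  have := (S.isSolution_flow t w').inner_flow w hx
  simpa [flow_left] using this

/-! ### Uniform bounds under condition (B) -/

variable {S}

theorem ConditionB.exists_norm_flow_le (hB : S.ConditionB) :
    ∃ B : ℝ, 0 < B ∧ ∀ t, ∀ x ∈ Icc S.a S.b, ‖S.flow t x‖ ≤ B := by
  refine ⟨(⨆ t : ℝ, S.Bt t).toReal + 1, by positivity, fun t x hx => ?_⟩
  have h1 : ‖S.flow t x‖ₑ ≤ ⨆ t : ℝ, S.Bt t :=
    (le_iSup₂ (f := fun x (_ : x ∈ Icc S.a S.b) => ‖S.Φ t x‖ₑ) x hx).trans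
      (le_iSup (fun t => S.Bt t) t)
  have h2 := ENNReal.toReal_mono hB.ne h1
  rw [toReal_enorm] at h2
  linarith

theorem norm_le_mul_norm_act (w : EuclideanSpace ℂ (Fin d)) :
    ‖w‖ ≤ ‖S.P₁inv‖ * ‖act S.P₁ w‖ := by
  conv_lhs => rw [← S.P₁inv_act w]
  exact ContinuousLinearMap.le_opNorm _ _

/-- Under condition (B) the fundamental matrices are uniformly bounded from below. -/
theorem ConditionB.exists_norm_le_flow (hB : S.ConditionB) :
    ∃ K : ℝ, 0 < K ∧ ∀ t, ∀ x ∈ Icc S.a S.b, ∀ w, ‖w‖ ≤ K * ‖S.flow t x w‖ := by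
  obtain ⟨B, hB0, hB⟩ := hB.exists_norm_flow_le
  refine ⟨‖S.P₁inv‖ * (B * ‖act S.P₁‖) + 1, by positivity, fun t x hx w => ?_⟩
  have h1 : ‖act S.P₁ w‖ ≤ B * ‖act S.P₁‖ * ‖S.flow t x w‖ := by
    rcases (norm_nonneg (act S.P₁ w)).eq_or_lt' with h0 | h0
    · rw [h0]; positivity
    refine le_of_mul_le_mul_left ?_ h0
    -- Testing the conservation law against `P₁ w` itself produces `‖P₁ w‖²` on one side.
    have h2 := S.inner_flow_flow t (act S.P₁ w) w hx
    calc ‖act S.P₁ w‖ * ‖act S.P₁ w‖ = ‖inner ℂ (act S.P₁ w) (act S.P₁ w)‖ := by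
          rw [inner_self_eq_norm_sq_to_K]; simp [sq]
      _ = ‖inner ℂ (S.flow t x (act S.P₁ w)) (act S.P₁ (S.flow t x w))‖ := by rw [h2]
      _ ≤ ‖S.flow t x (act S.P₁ w)‖ * ‖act S.P₁ (S.flow t x w)‖ := norm_inner_le_norm _ _
      _ ≤ (B * ‖act S.P₁ w‖) * (‖act S.P₁‖ * ‖S.flow t x w‖) := by
          gcongr
          · exact ContinuousLinearMap.le_of_opNorm_le _ (hB t x hx) _
          · exact ContinuousLinearMap.le_opNorm _ _
      _ = _ := by ring
  calc ‖w‖ ≤ ‖S.P₁inv‖ * ‖act S.P₁ w‖ := norm_le_mul_norm_act w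
    _ ≤ ‖S.P₁inv‖ * (B * ‖act S.P₁‖ * ‖S.flow t x w‖) := by gcongr
    _ ≤ _ := by nlinarith [norm_nonneg (S.flow t x w)]

theorem ConditionB.flow_surjective (hB : S.ConditionB) (t : ℝ) {x : ℝ} (hx : x ∈ Icc S.a S.b) :
    Function.Surjective (S.flow t x) := by
  obtain ⟨K, hK0, hK⟩ := hB.exists_norm_le_flow
  have hi : Function.Injective (S.flow t x).toLinearMap := by
    rw [← LinearMap.ker_eq_bot, LinearMap.ker_eq_bot']
    intro w hw
    have h1 := hK t x hx w
    rw [show S.flow t x w = 0 from hw, norm_zero, mul_zero] at h1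
    exact norm_le_zero_iff.1 h1
  exact LinearMap.injective_iff_surjective.1 hi

/-- Variation of constants, as an estimate. -/
theorem ConditionB.exists_norm_sub_flow_le (hB : S.ConditionB) :
    ∃ C : ℝ, 0 < C ∧ ∀ t v f, S.IsSolution t v f → ∀ x ∈ Icc S.a S.b,
      ‖v x - S.flow t x (v S.a)‖ ≤ C * ∫ s in S.a..S.b, ‖f s‖ := by
  obtain ⟨B, hB0, hBd⟩ := hB.exists_norm_flow_le
  refine ⟨B * (‖S.P₁inv‖ * B) + 1, by positivity, fun t v f h x hx => ?_⟩
  -- Transporting `v x` back to the left endpoint turns the quantity to be estimated into `Φ_t(x)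
  -- z`. The weak identity, tested with `P₁ z`, then bounds `z`.
  obtain ⟨w, hw⟩ := hB.flow_surjective t hx (v x)
  set z := w - v S.a with hz
  have hI : 0 ≤ ∫ s in S.a..S.b, ‖f s‖ :=
    intervalIntegral.integral_nonneg S.a_lt_b.le fun _ _ => norm_nonneg _
  have h1 : ∀ y, inner ℂ y (act S.P₁ z) = ∫ s in S.a..x, inner ℂ (S.flow t s y) (f s) := by
    intro y
    have e1 := h.inner_flow y hx
    rw [← hw, S.inner_flow_flow t y w hx] at e1
    rw [hz, map_sub, inner_sub_right, e1]
    abel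
  have h2 : ‖act S.P₁ z‖ ≤ B * ∫ s in S.a..S.b, ‖f s‖ := by
    rcases (norm_nonneg (act S.P₁ z)).eq_or_lt' with h0 | h0
    · rw [h0]; positivity
    refine le_of_mul_le_mul_left ?_ h0
    calc ‖act S.P₁ z‖ * ‖act S.P₁ z‖ = ‖inner ℂ (act S.P₁ z) (act S.P₁ z)‖ := by
          rw [inner_self_eq_norm_sq_to_K]; simp [sq]
      _ = ‖∫ s in S.a..x, inner ℂ (S.flow t s (act S.P₁ z)) (f s)‖ := by rw [h1]
      _ ≤ ∫ s in S.a..x, B * ‖act S.P₁ z‖ * ‖f s‖ := by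
          refine intervalIntegral.norm_integral_le_of_norm_le hx.1
            (Filter.Eventually.of_forall fun s hs => ?_)
            ((h.integrable.mono_Icc S.a_lt_b.le le_rfl hx.1 hx.2).norm.const_mul _)
          refine (norm_inner_le_norm _ _).trans ?_
          gcongr
          exact ContinuousLinearMap.le_of_opNorm_le _ (hBd t s ⟨hs.1.le, hs.2.trans hx.2⟩) _
      _ = B * ‖act S.P₁ z‖ * ∫ s in S.a..x, ‖f s‖ := intervalIntegral.integral_const_mul _ _
      _ ≤ B * ‖act S.P₁ z‖ * ∫ s in S.a..S.b, ‖f s‖ := by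
          gcongr
          exact intervalIntegral.integral_mono_interval le_rfl hx.1 hx.2
            (Filter.Eventually.of_forall fun _ => norm_nonneg _) h.integrable.norm
      _ = _ := by ring
  calc ‖v x - S.flow t x (v S.a)‖ = ‖S.flow t x z‖ := by rw [hz, map_sub, hw]
    _ ≤ B * ‖z‖ := ContinuousLinearMap.le_of_opNorm_le _ (hBd t x hx) _
    _ ≤ B * (‖S.P₁inv‖ * ‖act S.P₁ z‖) := by gcongr; exact norm_le_mul_norm_act z
    _ ≤ B * (‖S.P₁inv‖ * (B * ∫ s in S.a..S.b, ‖f s‖)) := by gcongr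
    _ ≤ _ := by nlinarith

end PortHamiltonian

/-! ### The energy norm compared with sup and integral bounds -/

namespace PortHamiltonian

variable {d : ℕ} (S : PortHamiltonian d)

theorem exists_norm_act_density_le : ∃ M : ℝ, 0 < M ∧ ∀ᵐ x ∂S.μ, ‖act (S.ℋ x)‖ ≤ M := by
  obtain ⟨c, hc0, hc⟩ := exists_norm_act_le d
  obtain ⟨K, hK⟩ := S.ℋ_upper
  refine ⟨c * |K| + 1, by positivity, ?_⟩
  filter_upwards [hK] with x hx
  have h1 : ‖act (S.ℋ x)‖ ≤ c * ‖S.ℋ x‖ := hc (S.ℋ x)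
  have h2 : c * ‖S.ℋ x‖ ≤ c * |K| := by
    gcongr
    exact hx.trans (le_abs_self K)
  linarith

theorem exists_norm_invDensity_le : ∃ c : ℝ, 0 < c ∧ ∀ᵐ x ∂S.μ, ‖S.invDensity x‖ ≤ c := by
  obtain ⟨c, hc⟩ := S.exists_norm_inv_le
  refine ⟨|c| + 1, by positivity, ?_⟩
  filter_upwards [hc] with x hx
  have h1 : ‖S.invDensity x‖ ≤ c := hx
  linarith [le_abs_self c]

theorem aestronglyMeasurable_invDensity : AEStronglyMeasurable S.invDensity S.μ :=
  (LinearMap.toContinuousLinearMap (LinearMapClass.linearMap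
    (Matrix.toEuclideanCLM (n := Fin d) (𝕜 := ℂ)))).continuous.comp_aestronglyMeasurable
    S.aestronglyMeasurable_inv

theorem aestronglyMeasurable_invDensity_apply {v : ℝ → EuclideanSpace ℂ (Fin d)}
    (hv : AEStronglyMeasurable v S.μ) :
    AEStronglyMeasurable (fun x => S.invDensity x (v x)) S.μ :=
  (ContinuousLinearMap.restrictScalarsL ℂ (EuclideanSpace ℂ (Fin d))
    (EuclideanSpace ℂ (Fin d)) ℝ ℝ).aestronglyMeasurable_comp₂
    S.aestronglyMeasurable_invDensity hv

namespace Space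

variable {S}

theorem norm_sq_eq (u : S.Space) :
    ‖u‖ ^ 2 = ∫ x, (inner ℂ (u.toFun x) (act (S.ℋ x) (u.toFun x))).re ∂S.μ := by
  rw [← inner_self_eq_norm_sq (𝕜 := ℂ) u]
  exact (integral_re (u.integrable_inner u)).symm

theorem intervalIntegrable (u : S.Space) : IntervalIntegrable u.toFun volume S.a S.b := by
  rw [intervalIntegrable_iff_integrableOn_Icc_of_le S.a_lt_b.le]
  exact (Lp.memLp (show Lp (EuclideanSpace ℂ (Fin d)) 2 S.μ from u)).integrable (by norm_num)

theorem exists_toFun_eq {h : ℝ → EuclideanSpace ℂ (Fin d)} (hm : AEStronglyMeasurable h S.μ)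
    {D : ℝ} (hD : ∀ᵐ x ∂S.μ, ‖h x‖ ≤ D) : ∃ u : S.Space, u.toFun =ᵐ[S.μ] h := by
  have hL : MemLp h 2 S.μ := MemLp.of_bound hm D hD
  exact ⟨hL.toLp h, hL.coeFn_toLp⟩

variable (S) in
theorem exists_norm_le_of_bound : ∃ C : ℝ, 0 < C ∧ ∀ (u : S.Space) (D : ℝ), 0 ≤ D →
    (∀ᵐ x ∂S.μ, ‖u.toFun x‖ ≤ D) → ‖u‖ ≤ C * D := by
  obtain ⟨M, hM0, hM⟩ := S.exists_norm_act_density_le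
  have hab : 0 < S.b - S.a := sub_pos.2 S.a_lt_b
  -- Adding 1 avoids a square root: for `r ≥ 0` one has `r ≤ (r + 1) ^ 2`, so the bound on `‖u‖ ^ 2`
  -- gives one on `‖u‖`.
  refine ⟨M * (S.b - S.a) + 1, by positivity, fun u D hD h => ?_⟩
  have h1 : ‖u‖ ^ 2 ≤ ∫ _x, M * D ^ 2 ∂S.μ := by
    rw [norm_sq_eq]
    refine integral_mono_ae (u.integrable_inner u).re (integrable_const _) ?_
    filter_upwards [hM, h] with x h1 h2
    calc (inner ℂ (u.toFun x) (act (S.ℋ x) (u.toFun x))).re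
        ≤ ‖u.toFun x‖ * ‖act (S.ℋ x) (u.toFun x)‖ :=
          (Complex.re_le_norm _).trans (norm_inner_le_norm _ _)
      _ ≤ D * (M * D) := by
          gcongr
          exact (ContinuousLinearMap.le_opNorm _ _).trans (by gcongr)
      _ = M * D ^ 2 := by ring
  rw [setIntegral_const, Real.volume_real_Icc_of_le S.a_lt_b.le, smul_eq_mul] at h1
  refine abs_le_of_sq_le_sq' ?_ (by positivity) |>.2
  refine h1.trans ?_
  have : (S.b - S.a) * (M * D ^ 2) = (M * (S.b - S.a)) * D ^ 2 := by ring
  rw [this, mul_pow]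
  have h2 : 0 < M * (S.b - S.a) := by positivity
  gcongr
  nlinarith

variable (S) in
-- In place of Cauchy–Schwarz, the inequality $r\le s+r^2/s$ with $s=\|u\|_H$ is integrated, and
-- coercivity of $\mathcal H$ bounds the quadratic term by $\|u\|_H$.
theorem exists_integral_norm_le : ∃ C : ℝ, 0 < C ∧ ∀ u : S.Space,
    ∫ x in S.a..S.b, ‖u.toFun x‖ ≤ C * ‖u‖ := by
  obtain ⟨k, hk, h⟩ := S.ℋ_lower
  have hab : 0 < S.b - S.a := sub_pos.2 S.a_lt_b
  refine ⟨(S.b - S.a) + k⁻¹, by positivity, fun u => ?_⟩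
  rw [intervalIntegral.integral_of_le S.a_lt_b.le, ← integral_Icc_eq_integral_Ioc]
  rcases (norm_nonneg u).eq_or_lt' with h0 | h0
  · have hu : u = 0 := norm_eq_zero.1 h0
    rw [h0, mul_zero]
    refine (integral_eq_zero_of_ae ?_).le
    filter_upwards [Space.toFun_zero (S := S)] with x hx
    rw [hu, hx, norm_zero]
    rfl
  · have hi : Integrable (fun x => ‖u.toFun x‖) S.μ :=
      ((intervalIntegrable_iff_integrableOn_Icc_of_le S.a_lt_b.le).1 u.intervalIntegrable).norm
    have hI : Integrable
        (fun x => (inner ℂ (u.toFun x) (act (S.ℋ x) (u.toFun x))).re) S.μ :=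
      (u.integrable_inner u).re
    calc ∫ x in Icc S.a S.b, ‖u.toFun x‖
        ≤ ∫ x, (‖u‖ + (k⁻¹ * ‖u‖⁻¹) *
            (inner ℂ (u.toFun x) (act (S.ℋ x) (u.toFun x))).re) ∂S.μ := by
          refine integral_mono_ae hi ((integrable_const _).add (hI.const_mul _)) ?_
          filter_upwards [h] with x hx
          have h1 := le_re_inner_act hx (u.toFun x)
          have h2 : ‖u.toFun x‖ ≤ ‖u‖ + ‖u‖⁻¹ * ‖u.toFun x‖ ^ 2 := by
            rw [← sub_nonneg]
            have : ‖u‖ + ‖u‖⁻¹ * ‖u.toFun x‖ ^ 2 - ‖u.toFun x‖ =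
                ‖u‖⁻¹ * (‖u‖ ^ 2 + ‖u.toFun x‖ ^ 2 - ‖u‖ * ‖u.toFun x‖) := by
              field_simp
            rw [this]
            refine mul_nonneg (by positivity) ?_
            nlinarith [sq_nonneg (‖u‖ - ‖u.toFun x‖), sq_nonneg ‖u‖, sq_nonneg ‖u.toFun x‖]
          refine h2.trans ?_
          have h3 : ‖u.toFun x‖ ^ 2 ≤
              k⁻¹ * (inner ℂ (u.toFun x) (act (S.ℋ x) (u.toFun x))).re := by
            rw [inv_mul_eq_div, le_div_iff₀ hk]
            linarith
          calc ‖u‖ + ‖u‖⁻¹ * ‖u.toFun x‖ ^ 2 ≤ ‖u‖ + ‖u‖⁻¹ *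
                (k⁻¹ * (inner ℂ (u.toFun x) (act (S.ℋ x) (u.toFun x))).re) := by gcongr
            _ = _ := by ring
      _ = (S.b - S.a) * ‖u‖ + (k⁻¹ * ‖u‖⁻¹) * ‖u‖ ^ 2 := by
          rw [integral_add (integrable_const _) (hI.const_mul _), integral_const_mul,
            setIntegral_const, Real.volume_real_Icc_of_le S.a_lt_b.le, smul_eq_mul, norm_sq_eq u]
      _ = _ := by field_simp

theorem toFun_sub (u v : S.Space) :
    (u - v).toFun =ᵐ[S.μ] fun x => u.toFun x - v.toFun x := by
  have h := u.toFun_add ((-1 : ℂ) • v)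
  rw [neg_one_smul, ← sub_eq_add_neg] at h
  filter_upwards [h, v.toFun_smul (-1)] with x h1 h2
  rw [neg_one_smul] at h2
  rw [h1, h2, neg_one_smul, sub_eq_add_neg]

end Space

/-! ### Boundary values and the passage from operator to differential equation -/

/-- The boundary operator `(p, q) ↦ W [p; q]`. -/
noncomputable def boundary : EuclideanSpace ℂ (Fin d) × EuclideanSpace ℂ (Fin d) →L[ℂ]
    EuclideanSpace ℂ (Fin d) :=
  LinearMap.toContinuousLinearMap
    { toFun := fun p => WithLp.toLp 2 ((complexify S.W).mulVec (Sum.elim p.1 p.2))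
      map_add' := fun p q => by
        rw [← WithLp.toLp_add, ← Matrix.mulVec_add]
        congr 2
        ext (i | i) <;> rfl
      map_smul' := fun r p => by
        rw [RingHom.id_apply, ← WithLp.toLp_smul, ← Matrix.mulVec_smul]
        congr 2
        ext (i | i) <;> rfl }

theorem boundary_apply (p q : EuclideanSpace ℂ (Fin d)) :
    S.boundary (p, q) = WithLp.toLp 2 ((complexify S.W).mulVec (Sum.elim p q)) := rfl

/-- Thus $T_ty$ measures how far the homogeneous solution starting at $y$ is from satisfying the
boundary condition. -/
theorem toEuclideanCLM_T (t : ℝ) (y : EuclideanSpace ℂ (Fin d)) :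
    Matrix.toEuclideanCLM (n := Fin d) (𝕜 := ℂ) (S.T t) y =
      S.boundary (S.flow t S.b y, y) := by
  rw [boundary_apply]
  change WithLp.toLp 2 ((S.T t).mulVec y) = _
  have hT : S.T t = @HMul.hMul _ _ _ Matrix.instHMulOfFintypeOfMulOfAddCommMonoid
      (complexify S.W) (Matrix.fromRows (S.Φ t S.b) 1) := rfl
  rw [hT, ← Matrix.mulVec_mulVec, Matrix.fromRows_mulVec, Matrix.one_mulVec]
  rfl

theorem exists_boundary_rightInverse :
    ∃ Z : EuclideanSpace ℂ (Fin d) →L[ℂ] EuclideanSpace ℂ (Fin d) × EuclideanSpace ℂ (Fin d),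
      ∀ y, S.boundary (Z y) = y := by
  have h1 : Function.Surjective S.W.mulVec := by
    have h2 : LinearMap.range S.W.mulVecLin = ⊤ := by
      apply Submodule.eq_top_of_finrank_eq
      have := S.W_rank
      rw [Matrix.rank] at this
      rw [this, Module.finrank_fin_fun]
    exact LinearMap.range_eq_top.1 h2
  -- The rank condition concerns the real matrix, so the right inverse is found over `ℝ` and then
  -- complexified.
  obtain ⟨X, hX⟩ := Matrix.mulVec_surjective_iff_exists_right_inverse.1 h1
  have hXc : complexify S.W * complexify X = 1 := by
    have := congrArg (fun A => A.map (fun r : ℝ => (r : ℂ))) hX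
    rw [← Matrix.map_one (fun r : ℝ => (r : ℂ)) Complex.ofReal_zero Complex.ofReal_one, ← this]
    exact (Matrix.map_mul (f := Complex.ofRealHom)).symm
  have hs : Function.Surjective S.boundary.toLinearMap := by
    intro y
    refine ⟨(WithLp.toLp 2 fun i => (complexify X).mulVec y (Sum.inl i),
      WithLp.toLp 2 fun i => (complexify X).mulVec y (Sum.inr i)), ?_⟩
    change S.boundary _ = y
    rw [boundary_apply]
    have : (Sum.elim (fun i => (complexify X).mulVec y (Sum.inl i))
        (fun i => (complexify X).mulVec y (Sum.inr i)) : Fin d ⊕ Fin d → ℂ) =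
        (complexify X).mulVec y := by
      ext (i | i) <;> rfl
    change WithLp.toLp 2 ((complexify S.W).mulVec (Sum.elim _ _)) = y
    rw [this, Matrix.mulVec_mulVec, hXc, Matrix.one_mulVec]
  obtain ⟨Z, hZ⟩ := S.boundary.toLinearMap.exists_rightInverse_of_surjective
    (LinearMap.range_eq_top.2 hs)
  exact ⟨LinearMap.toContinuousLinearMap Z, fun y => congrArg (fun L => L y) hZ⟩

variable {S}

/-- The substitution $v=\mathcal Hu$, with $\mathcal H^{-1}v$ replacing $u$ in the term $\mathrm
itu$. -/
theorem exists_isSolution_of_mem_graph (t : ℝ) {u w : S.Space} (h : (u, w) ∈ S.graph) :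
    ∃ v, S.IsSolution t v ((Complex.I * (t : ℂ)) • u + w).toFun ∧
      v =ᵐ[S.μ] (fun x => act (S.ℋ x) (u.toFun x)) ∧ S.boundary (v S.b, v S.a) = 0 := by
  obtain ⟨v, g, h1, h2, h3, h4⟩ := h
  refine ⟨v, ⟨Space.intervalIntegrable _, g, ⟨h1.intervalIntegrable S.a_lt_b.le, h1.2⟩, ?_⟩,
    h2, ?_⟩
  · filter_upwards [Space.toFun_add ((Complex.I * (t : ℂ)) • u) w,
      Space.toFun_smul (Complex.I * (t : ℂ)) u, h2, h4, S.ae_invDensity] with x e1 e2 e3 e4 e5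
    rw [e1, e2, e3, e5.1]
    rw [show w.toFun x = _ from e4, add_assoc, e3]
  · rw [boundary_apply, h3]
    rfl

/-- The converse substitution $u=\mathcal H^{-1}v$. Boundedness of `f` is what puts `f`, `u` and the
derivative of `v` in $L^2$. -/
theorem IsSolution.exists_mem_graph {t : ℝ} {v f : ℝ → EuclideanSpace ℂ (Fin d)}
    (h : S.IsSolution t v f) {D : ℝ} (hD : ∀ᵐ x ∂S.μ, ‖f x‖ ≤ D)
    (hb : S.boundary (v S.b, v S.a) = 0) :
    ∃ u F : S.Space, v =ᵐ[S.μ] (fun x => act (S.ℋ x) (u.toFun x)) ∧ F.toFun =ᵐ[S.μ] f ∧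
      (u, F - (Complex.I * (t : ℂ)) • u) ∈ S.graph := by
  obtain ⟨g, hv, hg⟩ := h.exists_primitive
  obtain ⟨c, hc0, hc⟩ := S.exists_norm_invDensity_le
  have hvc := hv.continuousOn S.a_lt_b.le
  obtain ⟨Cv, hCv⟩ := isCompact_Icc.exists_bound_of_continuousOn hvc
  have hvm : AEStronglyMeasurable v S.μ := hvc.aestronglyMeasurable measurableSet_Icc
  have hCv' : ∀ᵐ x ∂S.μ, ‖v x‖ ≤ Cv := (ae_restrict_iff' measurableSet_Icc).2
    (Filter.Eventually.of_forall hCv)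
  have hNv : ∀ᵐ x ∂S.μ, ‖S.invDensity x (v x)‖ ≤ c * Cv := by
    filter_upwards [hc, hCv'] with x h1 h2
    exact (ContinuousLinearMap.le_opNorm _ _).trans (by gcongr)
  obtain ⟨u, hu⟩ := Space.exists_toFun_eq (S.aestronglyMeasurable_invDensity_apply hvm) hNv
  have hfm : AEStronglyMeasurable f S.μ :=
    ((intervalIntegrable_iff_integrableOn_Icc_of_le S.a_lt_b.le).1 h.integrable).1
  obtain ⟨F, hF⟩ := Space.exists_toFun_eq hfm hD
  have hgm : AEStronglyMeasurable g S.μ :=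
    ((intervalIntegrable_iff_integrableOn_Icc_of_le S.a_lt_b.le).1 hv.1).1
  -- The equation expresses `P₁ g` through `f` and the bounded function `v`, so `g` is bounded.
  have hg2 : MemLp g 2 S.μ := by
    refine MemLp.of_bound hgm
      (‖S.P₁inv‖ * (D + ‖Complex.I * (t : ℂ)‖ * (c * Cv) + ‖act S.P₀‖ * Cv)) ?_
    filter_upwards [hg, hD, hNv, hCv'] with x e1 e2 e3 e4
    refine (norm_le_mul_norm_act (S := S) (g x)).trans ?_
    have e5 : act S.P₁ (g x) = f x - (Complex.I * (t : ℂ)) • S.invDensity x (v x) -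
        act S.P₀ (v x) := by
      rw [← e1]; abel
    rw [e5]
    gcongr
    refine (norm_sub_le _ _).trans (add_le_add ((norm_sub_le _ _).trans (add_le_add e2 ?_)) ?_)
    · rw [norm_smul]
      gcongr
    · exact (ContinuousLinearMap.le_opNorm _ _).trans (by gcongr)
  have hvu : v =ᵐ[S.μ] (fun x => act (S.ℋ x) (u.toFun x)) := by
    filter_upwards [hu, S.ae_invDensity] with x e1 e2
    rw [e1, e2.2.1]
  refine ⟨u, F, hvu, hF, v, g, ⟨hg2, hv.2⟩, hvu, ?_, ?_⟩
  · exact congrArg WithLp.ofLp hb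
  · filter_upwards [Space.toFun_sub F ((Complex.I * (t : ℂ)) • u),
      Space.toFun_smul (Complex.I * (t : ℂ)) u, hF, hu, hg] with x e1 e2 e3 e4 e5
    refine e1.trans ?_
    rw [e2, e3, e4, ← e5]
    abel

theorem isPrimitiveOn_affine {E : Type*} [NormedAddCommGroup E] [NormedSpace ℝ E]
    [CompleteSpace E] (a b c : ℝ) (p r : E) :
    IsPrimitiveOn a b (fun x => p + ((x - a) * c) • r) (fun _ => c • r) :=
  ⟨intervalIntegrable_const, fun x _ => by simp [smul_smul, mul_comm c]⟩

/-- When the constant in $\Phi_tw$ varies with $x$, only its derivative survives in the equation. An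
affine choice allows both endpoint values of the solution to be prescribed. -/
theorem isSolution_flow_affine (t c : ℝ) (p r : EuclideanSpace ℂ (Fin d)) :
    S.IsSolution t (fun x => S.flow t x (p + ((x - S.a) * c) • r))
      (fun x => act S.P₁ (S.flow t x (c • r))) := by
  refine ⟨?_, _, S.isPrimitiveOn_flow_apply t (isPrimitiveOn_affine S.a S.b c p r),
    Filter.Eventually.of_forall fun x => ?_⟩
  · refine ContinuousOn.intervalIntegrable ?_
    rw [uIcc_of_le S.a_lt_b.le]
    exact (act S.P₁).continuous.comp_continuousOn
      ((S.isPrimitiveOn_flow_const t (c • r)).continuousOn S.a_lt_b.le)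
  · rw [map_add (act S.P₁), odeOp_apply, map_neg (act S.P₁), act_P₁inv]
    abel

end PortHamiltonian

/-! ### Resolvents on the imaginary axis -/

namespace LinearPMap

variable {E : Type*} [NormedAddCommGroup E] [NormedSpace ℂ E]

theorem IsResolventAt.neg {A : E →ₗ.[ℂ] E} {z : ℂ} {R : E →L[ℂ] E} (h : A.IsResolventAt z R) :
    (-A).IsResolventAt (-z) (-R) := by
  refine ⟨fun f => ?_, fun u => ?_⟩
  · obtain ⟨h1, h2⟩ := h.1 f
    have h3 : (-R) f ∈ (-A).domain := A.domain.neg_mem h1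
    refine ⟨h3, ?_⟩
    have h4 : A ⟨(-R) f, h3⟩ = -A ⟨R f, h1⟩ := by
      rw [← LinearPMap.map_neg]
      rfl
    rw [LinearPMap.neg_apply, sub_neg_eq_add]
    change -z • -(R f) + A ⟨(-R) f, h3⟩ = f
    rw [h4, neg_smul_neg, ← sub_eq_add_neg, h2]
  · rw [LinearPMap.neg_apply, sub_neg_eq_add]
    change -R (-z • (u : E) + A u) = u
    rw [← ContinuousLinearMap.map_neg, neg_add, neg_smul, neg_neg, ← sub_eq_add_neg]
    exact h.2 u

theorem isResolventAt_resolvent {A : E →ₗ.[ℂ] E} {z : ℂ} (h : z ∈ A.resolventSet) :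
    A.IsResolventAt z (A.resolvent z) := by
  have h' : ∃ R, A.IsResolventAt z R := h
  rw [resolvent, dif_pos h']
  exact h'.choose_spec

end LinearPMap

namespace PortHamiltonian

variable {d : ℕ} {S : PortHamiltonian d}

variable (S) in
/-- The resolvent `(i t + 𝒜)⁻¹`. -/
noncomputable abbrev res (t : ℝ) :=
  (-S.𝒜).resolvent (Complex.I * (t : ℂ))

/-- The inverse of $\mathrm it+\mathcal A$ is minus the resolvent of $\mathcal A$ at $-\mathrm it$,
which is why the hypothesis is used at `-t`. -/
theorem isResolventAt_res (hres : ∀ t : ℝ, Complex.I * (t : ℂ) ∈ S.𝒜.resolventSet) (t : ℝ) :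
    (-S.𝒜).IsResolventAt (Complex.I * (t : ℂ)) (S.res t) := by
  apply LinearPMap.isResolventAt_resolvent
  obtain ⟨R, hR⟩ := hres (-t)
  refine ⟨-R, ?_⟩
  have := hR.neg
  simpa using this

theorem res_mem_graph (hres : ∀ t : ℝ, Complex.I * (t : ℂ) ∈ S.𝒜.resolventSet) (t : ℝ)
    (f : S.Space) : (S.res t f, f - (Complex.I * (t : ℂ)) • S.res t f) ∈ S.graph := by
  obtain ⟨h1, h2⟩ := (isResolventAt_res hres t).1 f
  rw [LinearPMap.neg_apply, sub_neg_eq_add] at h2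
  rw [← graph_𝒜, LinearPMap.mem_graph_iff]
  exact ⟨⟨S.res t f, h1⟩, rfl, eq_sub_of_add_eq' h2⟩

theorem res_apply_of_mem_graph (hres : ∀ t : ℝ, Complex.I * (t : ℂ) ∈ S.𝒜.resolventSet) (t : ℝ)
    {u w : S.Space} (h : (u, w) ∈ S.graph) : S.res t ((Complex.I * (t : ℂ)) • u + w) = u := by
  rw [← graph_𝒜, LinearPMap.mem_graph_iff] at h
  obtain ⟨y, hy, hw⟩ := h
  have h2 := (isResolventAt_res hres t).2 y
  rw [LinearPMap.neg_apply, sub_neg_eq_add] at h2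
  simp only at hy hw
  rwa [hw, hy] at h2

/-- The resolvent identity, obtained by applying the resolvent at `t` to $(\mathrm it+\mathcal
A)u=f+\mathrm i(t-s)u$ with $u$ the resolvent at `s` of `f`. -/
theorem res_sub_res (hres : ∀ t : ℝ, Complex.I * (t : ℂ) ∈ S.𝒜.resolventSet) (s t : ℝ)
    (f : S.Space) :
    S.res s f = S.res t f + (Complex.I * ((t - s : ℝ) : ℂ)) • S.res t (S.res s f) := by
  have h := res_apply_of_mem_graph hres t (res_mem_graph hres s f)
  conv_lhs => rw [← h]
  rw [← map_smul (S.res t), ← map_add]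
  congr 1
  rw [Complex.ofReal_sub, mul_sub, sub_smul]
  abel

/-- Near each point the resolvent identity bounds the resolvent by twice its norm at that point;
compactness of the interval does the rest. -/
theorem bddAbove_norm_res (hres : ∀ t : ℝ, Complex.I * (t : ℂ) ∈ S.𝒜.resolventSet) (η : ℝ) :
    BddAbove ((fun t => ‖S.res t‖) '' Icc (-η) η) := by
  refine isCompact_Icc.induction_on (p := fun s => BddAbove ((fun t => ‖S.res t‖) '' s)) (by simp)
    (fun s t hst ht => ht.mono (image_mono hst)) (fun s t hs ht => ?_) fun t _ => ?_
  · rw [image_union]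
    exact hs.union ht
  -- The radius makes `|t - s| * ‖S.res t‖` at most `1 / 2`, so the term with `‖S.res s‖` can be
  -- absorbed on the left.
  · refine ⟨_, mem_nhdsWithin_of_mem_nhds
      (Metric.ball_mem_nhds t (show 0 < (2 * (‖S.res t‖ + 1))⁻¹ by positivity)),
      2 * ‖S.res t‖, ?_⟩
    rintro _ ⟨s, hs, rfl⟩
    have h1 : ‖S.res s‖ ≤ ‖S.res t‖ + |t - s| * ‖S.res t‖ * ‖S.res s‖ := by
      refine ContinuousLinearMap.opNorm_le_bound _ (by positivity) fun f => ?_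
      conv_lhs => rw [res_sub_res hres s t f]
      refine (norm_add_le _ _).trans ?_
      rw [add_mul]
      refine add_le_add (ContinuousLinearMap.le_opNorm _ _) ?_
      rw [norm_smul, norm_mul, Complex.norm_I, one_mul, Complex.norm_real, Real.norm_eq_abs,
        mul_assoc, mul_assoc]
      gcongr
      refine (ContinuousLinearMap.le_opNorm _ _).trans ?_
      gcongr
      exact ContinuousLinearMap.le_opNorm _ _
    have h2 : |t - s| * ‖S.res t‖ ≤ 1 / 2 := by
      rw [Metric.mem_ball, dist_comm, Real.dist_eq] at hs
      have h3 : (2 * (‖S.res t‖ + 1))⁻¹ * ‖S.res t‖ ≤ 1 / 2 := by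
        rw [inv_mul_eq_div, div_le_iff₀ (by positivity)]
        linarith
      exact (mul_le_mul_of_nonneg_right hs.le (norm_nonneg _)).trans h3
    have h4 := mul_le_mul_of_nonneg_right h2 (norm_nonneg (S.res s))
    change ‖S.res s‖ ≤ 2 * ‖S.res t‖
    linarith

/-! ### The two estimates between $T_t^{-1}$ and the resolvent -/

/-- The fundamental matrix estimate: `T_t` is bounded from below by means of the resolvent. -/
theorem exists_norm_le_T (hres : ∀ t : ℝ, Complex.I * (t : ℂ) ∈ S.𝒜.resolventSet)
    (hB : S.ConditionB) : ∃ C : ℝ, 0 < C ∧ ∀ t y, ‖y‖ ≤ C * (‖S.res t‖ + 1) *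
      ‖Matrix.toEuclideanCLM (n := Fin d) (𝕜 := ℂ) (S.T t) y‖ := by
  obtain ⟨B, hB0, hBd⟩ := hB.exists_norm_flow_le
  obtain ⟨K, hK0, hK⟩ := hB.exists_norm_le_flow
  obtain ⟨M, hM0, hM⟩ := S.exists_norm_act_density_le
  obtain ⟨Z, hZ⟩ := S.exists_boundary_rightInverse
  obtain ⟨C₂, hC₂0, hC₂⟩ := Space.exists_norm_le_of_bound S
  obtain ⟨C₃, hC₃0, hC₃⟩ := Space.exists_integral_norm_le S
  set L := S.b - S.a with hL
  have hL0 : 0 < L := sub_pos.2 S.a_lt_b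
  have hbI : S.b ∈ Icc S.a S.b := right_mem_Icc.2 S.a_lt_b.le
  set ρ := (K + 1) * ‖Z‖ with hρ
  have hρ0 : 0 ≤ ρ := by positivity
  set D := ‖act S.P₁‖ * (B * (L⁻¹ * ρ)) with hDdef
  -- The first summand arises from averaging the resolvent bound over `[a, b]`, the second from the
  -- boundary correction; the 1 ensures positivity.
  refine ⟨L⁻¹ * (K * M * (C₃ * (C₂ * D))) + (‖Z‖ + ρ) + 1, by positivity, fun t y => ?_⟩
  set Y := ‖Matrix.toEuclideanCLM (n := Fin d) (𝕜 := ℂ) (S.T t) y‖ with hY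
  -- The pair `(p, q)` has the same image under `W` as `(Φ_t(b) y, y)`, but its size is controlled
  -- by `Y`. Subtracting it restores the boundary condition.
  obtain ⟨p, q, hpq⟩ : ∃ p q, Z (Matrix.toEuclideanCLM (n := Fin d) (𝕜 := ℂ) (S.T t) y) = (p, q) :=
    ⟨_, _, rfl⟩
  have hZn := Z.le_opNorm (Matrix.toEuclideanCLM (n := Fin d) (𝕜 := ℂ) (S.T t) y)
  have hZy := hZ (Matrix.toEuclideanCLM (n := Fin d) (𝕜 := ℂ) (S.T t) y)
  rw [hpq] at hZn hZy
  have hp : ‖p‖ ≤ ‖Z‖ * Y := (norm_fst_le (p, q)).trans hZn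
  have hq : ‖q‖ ≤ ‖Z‖ * Y := (norm_snd_le (p, q)).trans hZn
  obtain ⟨r₀, hr₀⟩ := hB.flow_surjective t hbI p
  have hr₀n := hK t _ hbI r₀
  rw [hr₀] at hr₀n
  have hr : ‖q - r₀‖ ≤ ρ * Y := by
    calc ‖q - r₀‖ ≤ ‖q‖ + ‖r₀‖ := norm_sub_le _ _
      _ ≤ ‖Z‖ * Y + K * (‖Z‖ * Y) := by gcongr; exact hr₀n.trans (by gcongr)
      _ = ρ * Y := by rw [hρ]; ring
  -- The affine parameter runs from `y - q` to `y - r₀`, so the solution takes the values `y - q` at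
  -- `a` and `Φ_t(b) y - p` at `b`.
  have hsol := S.isSolution_flow_affine t L⁻¹ (y - q) (q - r₀)
  have hfb : ∀ x ∈ Icc S.a S.b, ‖act S.P₁ (S.flow t x (L⁻¹ • (q - r₀)))‖ ≤ D * Y := by
    intro x hx
    calc ‖act S.P₁ (S.flow t x (L⁻¹ • (q - r₀)))‖
        ≤ ‖act S.P₁‖ * ‖S.flow t x (L⁻¹ • (q - r₀))‖ := ContinuousLinearMap.le_opNorm _ _
      _ ≤ ‖act S.P₁‖ * (B * ‖L⁻¹ • (q - r₀)‖) := by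
          gcongr
          exact ContinuousLinearMap.le_of_opNorm_le _ (hBd t x hx) _
      _ = ‖act S.P₁‖ * (B * (L⁻¹ * ‖q - r₀‖)) := by
          rw [norm_smul, Real.norm_of_nonneg (by positivity)]
      _ ≤ ‖act S.P₁‖ * (B * (L⁻¹ * (ρ * Y))) := by gcongr
      _ = D * Y := by rw [hDdef]; ring
  have hfb' := (ae_restrict_iff' (μ := volume) measurableSet_Icc).2
    (Filter.Eventually.of_forall hfb)
  obtain ⟨u, F, hu, hF, hg⟩ := hsol.exists_mem_graph hfb' (by
    simp only [sub_self, zero_mul, zero_smul, add_zero]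
    rw [← hL, mul_inv_cancel₀ hL0.ne', one_smul, flow_left,
      show y - q + (q - r₀) = y - r₀ by abel, map_sub, hr₀]
    have : (S.flow t S.b y - p, (1 : EuclideanSpace ℂ (Fin d) →L[ℂ] _) (y - q)) =
        (S.flow t S.b y, y) - (p, q) := rfl
    rw [this, map_sub, hZy, toEuclideanCLM_T, sub_self])
  have hFn : ‖F‖ ≤ C₂ * (D * Y) := by
    refine hC₂ F _ (by positivity) ?_
    filter_upwards [hF, hfb'] with x h1 h2
    rwa [h1]
  have hRF : S.res t F = u := by
    have := res_apply_of_mem_graph hres t hg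
    rwa [add_sub_cancel] at this
  have hun : ∫ x in S.a..S.b, ‖u.toFun x‖ ≤ C₃ * (‖S.res t‖ * (C₂ * (D * Y))) := by
    refine (hC₃ u).trans ?_
    rw [← hRF]
    gcongr
    exact (ContinuousLinearMap.le_opNorm _ _).trans (by gcongr)
  -- The uniform lower bound on `Φ_t(x)` recovers the affine parameter from `ℋ u`, and `y` differs
  -- from that parameter by at most `(‖Z‖ + ρ) * Y`.
  have hpt : ∀ᵐ x ∂S.μ, ‖y‖ ≤ K * M * ‖u.toFun x‖ + (‖Z‖ + ρ) * Y := by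
    filter_upwards [hu, hM, ae_restrict_mem measurableSet_Icc] with x h1 h2 hx
    set m := y - q + ((x - S.a) * L⁻¹) • (q - r₀) with hm
    have h3 : ‖m‖ ≤ K * (M * ‖u.toFun x‖) := by
      refine (hK t x hx m).trans ?_
      rw [h1]
      gcongr
      exact ContinuousLinearMap.le_of_opNorm_le _ h2 _
    have h4 : ‖((x - S.a) * L⁻¹) • (q - r₀)‖ ≤ ρ * Y := by
      have h5 : 0 ≤ (x - S.a) * L⁻¹ := mul_nonneg (sub_nonneg.2 hx.1) (by positivity)
      have h6 : (x - S.a) * L⁻¹ ≤ 1 := by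
        rw [← div_eq_mul_inv, div_le_one hL0, hL]
        linarith [hx.2]
      rw [norm_smul, Real.norm_of_nonneg h5]
      exact (mul_le_of_le_one_left (norm_nonneg _) h6).trans hr
    have h7 : y = m + q - ((x - S.a) * L⁻¹) • (q - r₀) := by rw [hm]; abel
    calc ‖y‖ = ‖m + q - ((x - S.a) * L⁻¹) • (q - r₀)‖ := by rw [← h7]
      _ ≤ ‖m‖ + ‖q‖ + ‖((x - S.a) * L⁻¹) • (q - r₀)‖ :=
          (norm_sub_le _ _).trans (add_le_add (norm_add_le _ _) le_rfl)
      _ ≤ K * (M * ‖u.toFun x‖) + ‖Z‖ * Y + ρ * Y := by gcongr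
      _ = _ := by ring
  have hint : L * ‖y‖ ≤ K * M * (∫ x in S.a..S.b, ‖u.toFun x‖) + L * ((‖Z‖ + ρ) * Y) := by
    have h1 := intervalIntegral.integral_mono_ae_restrict S.a_lt_b.le
      (intervalIntegrable_const (c := ‖y‖))
      ((u.intervalIntegrable.norm.const_mul (K * M)).add intervalIntegrable_const) hpt
    rw [intervalIntegral.integral_add (u.intervalIntegrable.norm.const_mul (K * M))
      intervalIntegrable_const, intervalIntegral.integral_const_mul,
      intervalIntegral.integral_const, intervalIntegral.integral_const] at h1
    exact h1
  have hfin : ‖y‖ ≤ L⁻¹ * (K * M * (C₃ * (‖S.res t‖ * (C₂ * (D * Y))))) + (‖Z‖ + ρ) * Y := by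
    refine le_of_mul_le_mul_left (hint.trans ?_) hL0
    rw [mul_add, mul_inv_cancel_left₀ hL0.ne']
    gcongr
  refine hfin.trans ?_
  have e : L⁻¹ * (K * M * (C₃ * (‖S.res t‖ * (C₂ * (D * Y))))) =
      (L⁻¹ * (K * M * (C₃ * (C₂ * D)))) * (‖S.res t‖ * Y) := by ring
  rw [e]
  have hY0 : 0 ≤ Y := norm_nonneg _
  have p1 : 0 ≤ L⁻¹ * (K * M * (C₃ * (C₂ * D))) := by positivity
  have p2 : 0 ≤ ‖Z‖ + ρ := by positivity
  have p3 : 0 ≤ ‖S.res t‖ * Y := by positivity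
  nlinarith [mul_nonneg p1 hY0, mul_nonneg p2 p3]

theorem isUnit_T (hres : ∀ t : ℝ, Complex.I * (t : ℂ) ∈ S.𝒜.resolventSet)
    (hB : S.ConditionB) (t : ℝ) : IsUnit (S.T t) := by
  obtain ⟨C, hC0, hC⟩ := exists_norm_le_T hres hB
  rw [← Matrix.mulVec_injective_iff_isUnit]
  intro y z hyz
  have h := hC t (WithLp.toLp 2 (y - z))
  have h0 : Matrix.toEuclideanCLM (n := Fin d) (𝕜 := ℂ) (S.T t) (WithLp.toLp 2 (y - z)) = 0 := by
    rw [Matrix.toEuclideanCLM_toLp, Matrix.mulVec_sub, show (S.T t).mulVec y = _ from hyz, sub_self]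
    rfl
  rw [h0, norm_zero, mul_zero] at h
  exact sub_eq_zero.1 (congrArg WithLp.ofLp (norm_le_zero_iff.1 h))

theorem exists_norm_inv_T_le (hres : ∀ t : ℝ, Complex.I * (t : ℂ) ∈ S.𝒜.resolventSet)
    (hB : S.ConditionB) : ∃ C : ℝ, 0 < C ∧ ∀ t, ‖(S.T t)⁻¹‖ ≤ C * (‖S.res t‖ + 1) := by
  obtain ⟨C, hC0, hC⟩ := exists_norm_le_T hres hB
  refine ⟨C, hC0, fun t => ?_⟩
  rw [Matrix.cstar_norm_def]
  refine ContinuousLinearMap.opNorm_le_bound _ (by positivity) fun f => ?_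
  have h := hC t (Matrix.toEuclideanCLM (n := Fin d) (𝕜 := ℂ) (S.T t)⁻¹ f)
  rwa [(toEuclideanCLM_inv_apply (isUnit_T hres hB t) f).2] at h

/-- The resolvent is bounded by means of `T_t⁻¹`. -/
theorem exists_norm_res_le (hres : ∀ t : ℝ, Complex.I * (t : ℂ) ∈ S.𝒜.resolventSet)
    (hB : S.ConditionB) : ∃ C : ℝ, 0 < C ∧ ∀ t, ‖S.res t‖ ≤ C * (‖(S.T t)⁻¹‖ + 1) := by
  obtain ⟨B, hB0, hBd⟩ := hB.exists_norm_flow_le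
  obtain ⟨C, hC0, hC⟩ := hB.exists_norm_sub_flow_le
  obtain ⟨c, hc0, hc⟩ := S.exists_norm_invDensity_le
  obtain ⟨C₂, hC₂0, hC₂⟩ := Space.exists_norm_le_of_bound S
  obtain ⟨C₃, hC₃0, hC₃⟩ := Space.exists_integral_norm_le S
  have hbI : S.b ∈ Icc S.a S.b := right_mem_Icc.2 S.a_lt_b.le
  refine ⟨C₂ * (c * (C * C₃)) * (B * ‖S.boundary‖ + 1), by positivity, fun t => ?_⟩
  refine ContinuousLinearMap.opNorm_le_bound _ (by positivity) fun f => ?_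
  obtain ⟨v, hv, hvu, hvb⟩ := exists_isSolution_of_mem_graph t (res_mem_graph hres t f)
  rw [add_sub_cancel] at hv
  have hest : ∀ x ∈ Icc S.a S.b, ‖v x - S.flow t x (v S.a)‖ ≤ C * C₃ * ‖f‖ := by
    intro x hx
    refine (hC t v _ hv x hx).trans ?_
    rw [mul_assoc]
    gcongr
    exact hC₃ f
  have hT : ‖Matrix.toEuclideanCLM (n := Fin d) (𝕜 := ℂ) (S.T t) (v S.a)‖ ≤
      ‖S.boundary‖ * (C * C₃ * ‖f‖) := by
    -- Since `W` annihilates the boundary values of `v`, the vector `T_t v(a)` only sees the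
    -- deviation of `v` from the homogeneous solution at `b`.
    have e : (S.flow t S.b (v S.a), v S.a) =
        (v S.b, v S.a) - (v S.b - S.flow t S.b (v S.a), 0) := by
      ext1 <;> simp
    rw [toEuclideanCLM_T, e, map_sub, hvb, zero_sub, norm_neg]
    refine (ContinuousLinearMap.le_opNorm _ _).trans ?_
    gcongr
    rw [Prod.norm_mk, norm_zero, max_eq_left (norm_nonneg _)]
    exact hest _ hbI
  have hva : ‖v S.a‖ ≤ ‖(S.T t)⁻¹‖ * (‖S.boundary‖ * (C * C₃ * ‖f‖)) := by
    rw [← (toEuclideanCLM_inv_apply (isUnit_T hres hB t) (v S.a)).1]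
    refine (ContinuousLinearMap.le_opNorm _ _).trans ?_
    rw [Matrix.cstar_norm_def]
    gcongr
  have hvx : ∀ x ∈ Icc S.a S.b, ‖v x‖ ≤
      B * (‖(S.T t)⁻¹‖ * (‖S.boundary‖ * (C * C₃ * ‖f‖))) + C * C₃ * ‖f‖ := by
    intro x hx
    calc ‖v x‖ = ‖S.flow t x (v S.a) + (v x - S.flow t x (v S.a))‖ := by rw [add_sub_cancel]
      _ ≤ ‖S.flow t x (v S.a)‖ + ‖v x - S.flow t x (v S.a)‖ := norm_add_le _ _
      _ ≤ B * ‖v S.a‖ + C * C₃ * ‖f‖ :=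
          add_le_add (ContinuousLinearMap.le_of_opNorm_le _ (hBd t x hx) _) (hest x hx)
      _ ≤ _ := by gcongr
  have hu := hC₂ (S.res t f)
    (c * (B * (‖(S.T t)⁻¹‖ * (‖S.boundary‖ * (C * C₃ * ‖f‖))) + C * C₃ * ‖f‖))
    (by positivity) (by
      filter_upwards [hvu, hc, S.ae_invDensity, ae_restrict_mem measurableSet_Icc]
        with x h1 h2 h3 hx
      rw [← h3.1 ((S.res t f).toFun x), ← h1]
      refine (ContinuousLinearMap.le_of_opNorm_le _ h2 _).trans ?_
      gcongr
      exact hvx x hx)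
  refine hu.trans ?_
  have e : C₂ * (c * (B * (‖(S.T t)⁻¹‖ * (‖S.boundary‖ * (C * C₃ * ‖f‖))) + C * C₃ * ‖f‖)) =
      C₂ * (c * (C * C₃)) * (B * ‖S.boundary‖ * ‖(S.T t)⁻¹‖ + 1) * ‖f‖ := by ring
  rw [e, mul_assoc (C₂ * (c * (C * C₃))) (B * ‖S.boundary‖ + 1)]
  gcongr
  have h0 : 0 ≤ B * ‖S.boundary‖ := by positivity
  nlinarith [norm_nonneg (S.T t)⁻¹]

/-! ### Absorbing the additive constants -/

/-- Condition (B) bounds $\|T_t\|$ uniformly, so $\|T_t^{-1}\|$ stays away from zero, provided that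
$d>0$. -/
theorem exists_one_le_norm_inv_T [Nontrivial (EuclideanSpace ℂ (Fin d))]
    (hres : ∀ t : ℝ, Complex.I * (t : ℂ) ∈ S.𝒜.resolventSet) (hB : S.ConditionB) :
    ∃ C : ℝ, 0 < C ∧ ∀ t, 1 ≤ C * ‖(S.T t)⁻¹‖ := by
  obtain ⟨B, hB0, hBd⟩ := hB.exists_norm_flow_le
  have hbI : S.b ∈ Icc S.a S.b := right_mem_Icc.2 S.a_lt_b.le
  refine ⟨‖S.boundary‖ * (B + 1) + 1, by positivity, fun t => ?_⟩
  obtain ⟨y, hy⟩ := exists_ne (0 : EuclideanSpace ℂ (Fin d))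
  have hy0 : 0 < ‖y‖ := norm_pos_iff.2 hy
  have h1 : ‖Matrix.toEuclideanCLM (n := Fin d) (𝕜 := ℂ) (S.T t) y‖ ≤
      ‖S.boundary‖ * ((B + 1) * ‖y‖) := by
    rw [toEuclideanCLM_T]
    refine (ContinuousLinearMap.le_opNorm _ _).trans ?_
    gcongr
    rw [Prod.norm_mk]
    have h2 := ContinuousLinearMap.le_of_opNorm_le _ (hBd t _ hbI) y
    exact max_le (by linarith) (by nlinarith)
  have h3 : ‖y‖ ≤ ‖(S.T t)⁻¹‖ * (‖S.boundary‖ * ((B + 1) * ‖y‖)) := by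
    conv_lhs => rw [← (toEuclideanCLM_inv_apply (isUnit_T hres hB t) y).1]
    refine (ContinuousLinearMap.le_opNorm _ _).trans ?_
    rw [Matrix.cstar_norm_def]
    gcongr
  have h4 : 1 ≤ ‖(S.T t)⁻¹‖ * (‖S.boundary‖ * (B + 1)) := by
    refine le_of_mul_le_mul_right ?_ hy0
    linarith
  nlinarith [norm_nonneg (S.T t)⁻¹]

/-- If the resolvent vanished, every pair $(0,f)$ would lie in the graph of the single-valued
operator $\mathcal A$, forcing $H=0$. -/
theorem norm_res_pos [Nontrivial (EuclideanSpace ℂ (Fin d))]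
    (hres : ∀ t : ℝ, Complex.I * (t : ℂ) ∈ S.𝒜.resolventSet) (t : ℝ) : 0 < ‖S.res t‖ := by
  rw [norm_pos_iff]
  intro h0
  obtain ⟨y, hy⟩ := exists_ne (0 : EuclideanSpace ℂ (Fin d))
  obtain ⟨f, hf⟩ := Space.exists_toFun_eq (S := S) (h := fun _ => y)
    aestronglyMeasurable_const (Filter.Eventually.of_forall fun _ => le_rfl)
  have h1 := res_mem_graph hres t f
  rw [h0] at h1
  have h2 : f = 0 := by
    have := S.graph_functional _ h1 rfl
    simpa using this
  have h3 : ∀ᵐ _x ∂S.μ, False := by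
    filter_upwards [hf, Space.toFun_zero (S := S)] with x e1 e2
    rw [h2, e2] at e1
    exact hy e1.symm
  rw [Filter.eventually_false_iff_eq_bot, ae_eq_bot, Measure.restrict_eq_zero, Real.volume_Icc,
    ENNReal.ofReal_eq_zero] at h3
  linarith [S.a_lt_b]

theorem subsingleton_space [Subsingleton (EuclideanSpace ℂ (Fin d))] : Subsingleton S.Space :=
  ⟨fun _ _ => sub_eq_zero.1 (Space.eq_zero_of_toFun
    (Filter.Eventually.of_forall fun _ => Subsingleton.elim _ _))⟩

theorem exists_norm_res_le_mul (hres : ∀ t : ℝ, Complex.I * (t : ℂ) ∈ S.𝒜.resolventSet)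
    (hB : S.ConditionB) : ∃ C : ℝ, 0 < C ∧ ∀ t, ‖S.res t‖ ≤ C * ‖(S.T t)⁻¹‖ := by
  rcases subsingleton_or_nontrivial (EuclideanSpace ℂ (Fin d)) with h | h
  -- For `d = 0` the norm of `T_t⁻¹` has no positive lower bound, but the resolvent vanishes too.
  · have := subsingleton_space (S := S)
    refine ⟨1, one_pos, fun t => ?_⟩
    rw [Subsingleton.elim (S.res t) 0, norm_zero]
    positivity
  · obtain ⟨C, hC0, hC⟩ := exists_norm_res_le hres hB
    obtain ⟨C', hC'0, hC'⟩ := exists_one_le_norm_inv_T hres hB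
    refine ⟨C * (1 + C'), by positivity, fun t => (hC t).trans ?_⟩
    rw [mul_assoc, add_mul, one_mul]
    gcongr
    exact hC' t

/-- The constant 1 is traded for a multiple of the resolvent norm at 0, a quantity that every
supremum $M(\eta)$ with $\eta\ge0$ dominates. -/
theorem exists_norm_inv_T_le_mul (hres : ∀ t : ℝ, Complex.I * (t : ℂ) ∈ S.𝒜.resolventSet)
    (hB : S.ConditionB) :
    ∃ C : ℝ, 0 < C ∧ ∀ t, ‖(S.T t)⁻¹‖ ≤ C * (‖S.res t‖ + ‖S.res 0‖) := by
  rcases subsingleton_or_nontrivial (EuclideanSpace ℂ (Fin d)) with h | h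
  · refine ⟨1, one_pos, fun t => ?_⟩
    rw [Matrix.cstar_norm_def, Subsingleton.elim (Matrix.toEuclideanCLM (n := Fin d) (𝕜 := ℂ)
      (S.T t)⁻¹) 0, norm_zero]
    positivity
  · obtain ⟨C, hC0, hC⟩ := exists_norm_inv_T_le hres hB
    have h0 := norm_res_pos hres 0
    refine ⟨C * (1 + ‖S.res 0‖⁻¹), by positivity, fun t => (hC t).trans ?_⟩
    rw [mul_assoc]
    gcongr
    have e : (1 + ‖S.res 0‖⁻¹) * (‖S.res t‖ + ‖S.res 0‖) =
        ‖S.res t‖ + 1 + ‖S.res 0‖ + ‖S.res 0‖⁻¹ * ‖S.res t‖ := by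
      field_simp
      ring
    rw [e]
    have : 0 ≤ ‖S.res 0‖⁻¹ * ‖S.res t‖ := by positivity
    linarith

theorem bddAbove_norm_inv_T (hres : ∀ t : ℝ, Complex.I * (t : ℂ) ∈ S.𝒜.resolventSet)
    (hB : S.ConditionB) (η : ℝ) : BddAbove ((fun t : ℝ => ‖(S.T t)⁻¹‖) '' Icc (-η) η) := by
  obtain ⟨C, hC0, hC⟩ := exists_norm_inv_T_le hres hB
  obtain ⟨M, hM⟩ := bddAbove_norm_res hres η
  refine ⟨C * (M + 1), ?_⟩
  rintro _ ⟨t, ht, rfl⟩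
  refine (hC t).trans ?_
  gcongr
  exact hM ⟨t, ht, rfl⟩

end PortHamiltonian

theorem corollary4p5 {d : ℕ} (S : PortHamiltonian d) (hacc : S.IsAccretive)
    (hres : ∀ t : ℝ, Complex.I * (t : ℂ) ∈ S.𝒜.resolventSet) (hB : S.ConditionB) :
    (∀ t : ℝ, IsUnit (S.T t)) ∧
    (∀ η : ℝ, 0 ≤ η →
      BddAbove ((fun t : ℝ => ‖(S.T t)⁻¹‖) '' Icc (-η) η) ∧
      BddAbove ((fun t : ℝ => ‖(-S.𝒜).resolvent (Complex.I * (t : ℂ))‖) '' Icc (-η) η)) ∧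
    ∃ c C : ℝ, 0 < c ∧ 0 < C ∧ ∀ η : ℝ, 0 ≤ η →
      c * S.m η ≤ (-S.𝒜).resolventGrowth η ∧ (-S.𝒜).resolventGrowth η ≤ C * S.m η := by
  refine ⟨PortHamiltonian.isUnit_T hres hB, fun η _ =>
    ⟨PortHamiltonian.bddAbove_norm_inv_T hres hB η, PortHamiltonian.bddAbove_norm_res hres η⟩, ?_⟩
  obtain ⟨C, hC0, hC⟩ := PortHamiltonian.exists_norm_res_le_mul hres hB
  obtain ⟨C', hC'0, hC'⟩ := PortHamiltonian.exists_norm_inv_T_le_mul hres hB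
  -- The factor 2 arises because the resolvents at `t` and at `0` are each bounded by `M(η)`.
  refine ⟨(C' * 2)⁻¹, C, by positivity, hC0, fun η hη => ?_⟩
  have h0 : (0 : ℝ) ∈ Icc (-η) η := ⟨neg_nonpos.2 hη, hη⟩
  have hM : ∀ t ∈ Icc (-η) η, ‖S.res t‖ ≤ (-S.𝒜).resolventGrowth η := fun t ht =>
    le_csSup (PortHamiltonian.bddAbove_norm_res hres η) ⟨t, ht, rfl⟩
  constructor
  · rw [inv_mul_eq_div, div_le_iff₀ (by positivity)]
    refine csSup_le ⟨_, 0, h0, rfl⟩ ?_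
    rintro _ ⟨t, ht, rfl⟩
    calc ‖(S.T t)⁻¹‖ ≤ C' * (‖S.res t‖ + ‖S.res 0‖) := hC' t
      _ ≤ C' * ((-S.𝒜).resolventGrowth η + (-S.𝒜).resolventGrowth η) := by
          gcongr
          · exact hM t ht
          · exact hM 0 h0
      _ = _ := by ring
  · refine csSup_le ⟨_, 0, h0, rfl⟩ ?_
    rintro _ ⟨t, ht, rfl⟩
    refine (hC t).trans ?_
    gcongr
    exact le_csSup (PortHamiltonian.bddAbove_norm_inv_T hres hB η) ⟨t, ht, rfl⟩
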